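/- Let $\mathrm{Sym}(N)$ be the space of real symmetric $N\times N$ matrices with the Frobenius inner product $\langle X,Y\rangle_F=\operatorname{tr}(XY)$; volumes, the Lebesgue measure $dQ$ on $\mathrm{Sym}(N)$, and transposes of linear maps $\mathrm{Sym}(N)\to\mathbb R^m$ are taken with respect to it (and the standard inner product of $\mathbb R^m$). Let $A_1,\dots,A_m\in\mathrm{Sym}(N)$ be linearly independent, $b\in\mathbb R^m$, $m<\binom{N+1}{2}$, and suppose that the spectrahedron $$\mathcal S=\{P\in\mathrm{Sym}(N): P\succeq 0,\ \operatorname{tr}(A_kP)=b_k\ (1\le k\le m)\}$$ is compact and of dimension exactly $\binom{N+1}{2}-m$. For positive definite $P$ put $$\phi(P)=\log\Gamma_N\!\left(\tfrac{N+1}{2}\right)-\tfrac{N(N+1)}{2}\log\!\left(\tfrac{N+1}{2e}\right)+\tfrac{N+1}{2}\log\det P,$$ where $\Gamma_N(a)=\int_{Q\succ 0}e^{-\operatorname{tr}Q}(\det Q)^{a-(N+1)/2}\,dQ$ is the multivariate gamma function, normalised by the Frobenius Lebesgue measure $dQ$ (so it is $2^{N(N-1)/4}$ times the multivariate gamma function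 normalised by $\prod_{i\le j}dq_{ij}$), and put $\phi(P)=-\infty$ for singular $P\succeq0$. For positive definite $P$ define linear operators $A,B:\mathrm{Sym}(N)\to\mathbb R^m$ by $$AX=(\operatorname{tr}(A_kX))_{k=1}^m,\qquad BX=\bigl(\operatorname{tr}(\sqrt{P}A_k\sqrt{P}\,X)\bigr)_{k=1}^m .$$ Theorem. Let $0<\epsilon\le e^{-1}$ and suppose that $$\frac{\epsilon^2}{\log^3(\epsilon^{-1})}\ \ge\ \frac{\gamma\,m^3\log N}{N},\qquad \gamma=32\cdot10^5 .$$ Then $\phi$ has a unique maximizer $P^\star$ over $\mathcal S$, it is positive definite, and, with $B$ formed from $P=P^\star$, the number $$F=\left(\frac{N+1}{4\pi}\right)^{m/2}\left(\frac{\det(AA^\top)}{\det(BB^\top)}\right)^{1/2}e^{\phi(P^\star)}$$ approximates the $\left(\binom{N+1}{2}-m\right)$-dimensional volume of $\mathcal S$ within relative error $\epsilon$, that is, $$\left|\frac{\operatorname{vol}(\mathcal S)}{F}-1\right|\le\epsilon .$$ -/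

import Mathlib

open MeasureTheory
open scoped MatrixOrder

namespace SpectraVol

noncomputable section

/-- The space of real symmetric `N × N` matrices, as a subspace of the Euclidean space of all
`N × N` arrays. It inherits the inner product `∑ i j, X i j * Y i j = tr (X Y)` (the Frobenius
inner product), and with it the metric, the Borel structure and the Lebesgue measure `volume`. -/
def symSubmodule (N : ℕ) : Submodule ℝ (EuclideanSpace ℝ (Fin N × Fin N)) where
  carrier := {X | ∀ i j, X (i, j) = X (j, i)}
  add_mem' := by
    intro X Y hX hY i j
    simp [hX i j, hY i j]
  zero_mem' := by
    intro i j
    simp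
  smul_mem' := by
    intro c X hX i j
    simp [hX i j]

abbrev Sym (N : ℕ) : Type := symSubmodule N

/-- The underlying matrix of an element of `Sym N`. -/
def toMat {N : ℕ} (X : Sym N) : Matrix (Fin N) (Fin N) ℝ :=
  Matrix.of fun i j => X.1 (i, j)

/-- The inner product of `Sym N` is the Frobenius inner product. -/
theorem inner_eq_trace {N : ℕ} (X Y : Sym N) :
    inner ℝ X Y = (toMat X * toMat Y).trace := by
  have h : inner ℝ X Y = ∑ p : Fin N × Fin N, inner ℝ (X.1 p) (Y.1 p) := PiLp.inner_apply _ _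
  rw [h, Fintype.sum_prod_type]
  simp only [Matrix.trace, Matrix.diag, Matrix.mul_apply, toMat, Matrix.of_apply]
  refine Finset.sum_congr rfl fun i _ => Finset.sum_congr rfl fun j _ => ?_
  rw [Y.2 j i, real_inner_eq_re_inner, RCLike.inner_apply]
  simp [mul_comm]

/-- For matrices `C 1, …, C m`, the linear operator
`Sym N → ℝ ^ m`, `X ↦ (tr (C 1 X), …, tr (C m X))`. -/
def traceMap {N m : ℕ} (C : Fin m → Matrix (Fin N) (Fin N) ℝ) :
    Sym N →ₗ[ℝ] EuclideanSpace ℝ (Fin m) where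
  toFun X := WithLp.toLp 2 fun k => (C k * toMat X).trace
  map_add' := by
    intro X Y
    have h : toMat (X + Y) = toMat X + toMat Y := by
      ext i j
      simp [toMat]
    ext k
    simp [h, Matrix.mul_add, Matrix.trace_add]
  map_smul' := by
    intro c X
    have h : toMat (c • X) = c • toMat X := by
      ext i j
      simp [toMat]
    ext k
    simp [h, Matrix.trace_smul]

/-- `det (T Tᵀ)`, the transpose being the adjoint for the inner products of `Sym N` and `ℝ ^ m`. -/
def gramDet {N m : ℕ} (T : Sym N →ₗ[ℝ] EuclideanSpace ℝ (Fin m)) : ℝ :=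
  LinearMap.det (T ∘ₗ LinearMap.adjoint T)

/-- The spectrahedron of all positive semidefinite `P` with `tr (A k P) = b k` for every `k`. -/
def spectrahedron {N m : ℕ} (A : Fin m → Sym N) (b : Fin m → ℝ) : Set (Sym N) :=
  {P | (toMat P).PosSemidef ∧ ∀ k, (toMat (A k) * toMat P).trace = b k}

/-- The multivariate gamma function
`Γ_N (a) = ∫ exp (- tr Q) * det Q ^ (a - (N + 1) / 2) dQ` over the positive definite cone, where
`dQ` is the Lebesgue measure of the inner product space `Sym N`. -/
def multivariateGamma (N : ℕ) (a : ℝ) : ℝ :=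
  ∫ Q in {Q : Sym N | (toMat Q).PosDef},
    Real.exp (-(toMat Q).trace) * (toMat Q).det ^ (a - ((N : ℝ) + 1) / 2)

/-- The maximum entropy function `φ`, to be used at positive definite matrices. -/
def entropy {N : ℕ} (P : Sym N) : ℝ :=
  Real.log (multivariateGamma N (((N : ℝ) + 1) / 2))
    - (N : ℝ) * ((N : ℝ) + 1) / 2 * Real.log (((N : ℝ) + 1) / (2 * Real.exp 1))
    + ((N : ℝ) + 1) / 2 * Real.log (toMat P).det

/-- `P` maximizes `φ` over the spectrahedron. As `φ = -∞` at singular matrices, only the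
positive definite points compete. -/
def IsEntropyMaximizer {N m : ℕ} (A : Fin m → Sym N) (b : Fin m → ℝ) (P : Sym N) : Prop :=
  P ∈ spectrahedron A b ∧ (toMat P).PosDef ∧
    ∀ Q ∈ spectrahedron A b, (toMat Q).PosDef → entropy Q ≤ entropy P

/-- The operator `A X = (tr (A k X))_k`. -/
def opA {N m : ℕ} (A : Fin m → Sym N) : Sym N →ₗ[ℝ] EuclideanSpace ℝ (Fin m) :=
  traceMap fun k => toMat (A k)

/-- The operator `B X = (tr (√P (A k) √P X))_k`, where `√P` is the positive semidefinite
square root. -/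
def opB {N m : ℕ} (A : Fin m → Sym N) (P : Sym N) : Sym N →ₗ[ℝ] EuclideanSpace ℝ (Fin m) :=
  traceMap fun k => CFC.sqrt (toMat P) * toMat (A k) * CFC.sqrt (toMat P)

/-- The approximation formula
`((N + 1) / (4 π)) ^ (m / 2) * (det (A Aᵀ) / det (B Bᵀ)) ^ (1 / 2) * exp (φ P)`. -/
def volumeFormula {N m : ℕ} (A : Fin m → Sym N) (P : Sym N) : ℝ :=
  (((N : ℝ) + 1) / (4 * Real.pi)) ^ ((m : ℝ) / 2)
    * Real.sqrt (gramDet (opA A) / gramDet (opB A P))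
    * Real.exp (entropy P)

/-- The volume of the spectrahedron: its Euclidean (Lebesgue-normalized Hausdorff) measure in
dimension `(N + 1).choose 2 - m`, for the Frobenius metric. -/
def spectrahedronVolume {N m : ℕ} (A : Fin m → Sym N) (b : Fin m → ℝ) : ℝ :=
  (μHE[(N + 1).choose 2 - m] (spectrahedron A b)).toReal

end

end SpectraVol

/-!
The volume of the spectrahedron is computed from a probability density on the semidefinite cone.
Put `n = (N + 1) / 2`. For positive definite `P`, the weight `Q ↦ exp (-n tr (P⁻¹ Q))` on the cone
is, up to normalization, the density of largest entropy among those of mean `P`. When `P`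
maximizes the determinant over the spectrahedron, stationarity says that `P⁻¹` is orthogonal to
the kernel of `A`; so the weight is constant on the spectrahedron, and its integral over the
affine slice through `P` is `exp (-n N)` times the volume (`integral_slice_coneWeight`).

That integral is evaluated by Fourier inversion on the orthogonal complement of the kernel of `A`,
a space of dimension `m` (`integral_slice_eq`). Inversion holds at the slice through `P` itself,
because the singular matrices form a null set of the slice and the slice integrals are therefore
continuous there (`continuousAt_slice_coneWeight`). The characteristic function is explicit: the
Laplace transform of the cone at `n P⁻¹ - z ξ` is `det (n P⁻¹ - z ξ) ^ (-n)` up to a constant,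
which continues analytically from real `z` to a strip (`integral_cexp_strip`). In terms of the
eigenvalues `x j` of `(2 π / n) √P ξ √P`, the centered characteristic function is
`∏ j, ((1 + i x j) * exp (-i x j)) ^ (-n)`.

With `ρ² = ∑ j, (x j)²`, a cubic Taylor bound of `log (1 + i x)`, uniform on the whole line, and
`∏ j, (1 + (x j)²) ≥ 1 + ρ²` show that this function differs from `exp (-n ρ² / 2)` by at most
`(n / 3) ρ³ (1 + ρ²) ^ (-n / 2)` everywhere (`norm_charFactor_sub_le`). No splitting into a central
region and tails is needed, because the radial moments of the weight `(1 + ρ²) ^ (-n / 2)` on a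
space of dimension `m` are explicit multiples of its mass (`integral_error_le`). The Gaussian
integrates to the stated formula (`volumeFormula_eq`), where the Gram determinants appear as the
Jacobian of `ξ ↦ √P ξ √P`. The resulting relative error is at most `m √(m / n)`
(`abs_volume_sub_le`), which the assumption on `ε` makes smaller than `ε` (`size_bounds`).

A positive definite point exists because a spectrahedron of the full dimension cut out by fewer
than `N` equations cannot lie in the singular matrices (`exists_posDef_mem_spectrahedron`), and
uniqueness of the maximizer is strict concavity of `log det`.
-/

namespace SpectraVol

/-! ### Symmetric matrices, their eigenvalues, and congruence -/

/-- The underlying matrix, as a linear map. -/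
def toMatₗ (N : ℕ) : Sym N →ₗ[ℝ] Matrix (Fin N) (Fin N) ℝ where
  toFun := toMat
  map_add' _ _ := by ext i j; simp [toMat]
  map_smul' _ _ := by ext i j; simp [toMat]

variable {N : ℕ}

theorem toMat_add (X Y : Sym N) : toMat (X + Y) = toMat X + toMat Y := (toMatₗ N).map_add X Y

theorem toMat_sub (X Y : Sym N) : toMat (X - Y) = toMat X - toMat Y := (toMatₗ N).map_sub X Y

theorem toMat_smul (c : ℝ) (X : Sym N) : toMat (c • X) = c • toMat X := (toMatₗ N).map_smul c X

theorem toMat_zero : toMat (0 : Sym N) = 0 := (toMatₗ N).map_zero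

theorem toMat_injective : Function.Injective (toMat : Sym N → Matrix (Fin N) (Fin N) ℝ) := by
  intro X Y h
  ext p
  exact congrFun (congrFun h p.1) p.2

theorem continuous_toMat : Continuous (toMat : Sym N → Matrix (Fin N) (Fin N) ℝ) :=
  (toMatₗ N).continuous_of_finiteDimensional

theorem toMat_transpose (X : Sym N) : (toMat X).transpose = toMat X := by
  ext i j
  exact (X.2 i j).symm

theorem toMat_isHermitian (X : Sym N) : (toMat X).IsHermitian := by
  rw [Matrix.IsHermitian, Matrix.conjTranspose_eq_transpose_of_trivial, toMat_transpose]

/-- A symmetric matrix as an element of `Sym N`. -/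
def ofMat (C : Matrix (Fin N) (Fin N) ℝ) (hC : C.transpose = C) : Sym N :=
  ⟨WithLp.toLp 2 fun p => C p.1 p.2, fun i j => (congrFun (congrFun hC i) j).symm⟩

@[simp]
theorem toMat_ofMat (C : Matrix (Fin N) (Fin N) ℝ) (hC : C.transpose = C) :
    toMat (ofMat C hC) = C := rfl

theorem norm_sq_eq_trace (X : Sym N) : ‖X‖ ^ 2 = (toMat X * toMat X).trace := by
  rw [← inner_eq_trace, real_inner_self_eq_norm_sq]

/-- The eigenvalues of a symmetric matrix, with multiplicity. -/
noncomputable def eig (X : Sym N) : Fin N → ℝ := (toMat_isHermitian X).eigenvalues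

/-- Symmetric matrices are orthogonally diagonalizable. -/
theorem exists_diagonalization (X : Sym N) :
    ∃ U : Matrix (Fin N) (Fin N) ℝ, U * U.transpose = 1 ∧ U.transpose * U = 1 ∧
        toMat X = U * Matrix.diagonal (eig X) * U.transpose := by
  have h := toMat_isHermitian X
  refine ⟨h.eigenvectorUnitary, ?_, ?_, ?_⟩
  · have := Unitary.coe_mul_star_self h.eigenvectorUnitary
    rwa [Unitary.coe_star, Matrix.star_eq_conjTranspose,
      Matrix.conjTranspose_eq_transpose_of_trivial] at this
  · have := Unitary.coe_star_mul_self h.eigenvectorUnitary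
    rwa [Matrix.star_eq_conjTranspose, Matrix.conjTranspose_eq_transpose_of_trivial] at this
  · have := h.spectral_theorem
    rw [Unitary.conjStarAlgAut_apply, Matrix.star_eq_conjTranspose,
      Matrix.conjTranspose_eq_transpose_of_trivial] at this
    exact this

/-- The congruence action `X ↦ C X Cᵀ` on symmetric matrices. -/
def congruence (C : Matrix (Fin N) (Fin N) ℝ) : Sym N →ₗ[ℝ] Sym N where
  toFun X := ofMat (C * toMat X * C.transpose) (by
    simp [Matrix.transpose_mul, toMat_transpose, Matrix.mul_assoc])
  map_add' X Y := toMat_injective (by simp [toMat_add, Matrix.mul_add, Matrix.add_mul])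
  map_smul' c X := toMat_injective (by simp [toMat_smul])

@[simp]
theorem toMat_congruence (C : Matrix (Fin N) (Fin N) ℝ) (X : Sym N) :
    toMat (congruence C X) = C * toMat X * C.transpose := rfl

theorem congruence_mul (C D : Matrix (Fin N) (Fin N) ℝ) :
    congruence (C * D) = congruence C ∘ₗ congruence D := by
  ext1 X
  exact toMat_injective (by simp [Matrix.transpose_mul, Matrix.mul_assoc])

theorem congruence_one : congruence (1 : Matrix (Fin N) (Fin N) ℝ) = LinearMap.id := by
  ext1 X
  exact toMat_injective (by simp)

/-- A symmetric matrix is determined by its entries on and above the diagonal. -/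
def upperEquiv (N : ℕ) : Sym N ≃ₗ[ℝ] ({p : Fin N × Fin N // p.1 ≤ p.2} → ℝ) where
  toFun X p := toMat X p.1.1 p.1.2
  map_add' X Y := by ext p; simp [toMat_add]
  map_smul' c X := by ext p; simp [toMat_smul]
  invFun f := ofMat (Matrix.of fun i j =>
    if h : i ≤ j then f ⟨(i, j), h⟩ else f ⟨(j, i), (not_le.mp h).le⟩) (by
      ext i j
      rcases lt_trichotomy i j with h | h | h
      · simp [h.le, h.not_ge]
      · simp [h]
      · simp [h.le, h.not_ge])
  left_inv X := by
    apply toMat_injective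
    ext i j
    by_cases h : i ≤ j
    · simp [h]
    · simp only [toMat_ofMat, Matrix.of_apply, h, dite_false]
      exact X.2 j i
  right_inv f := by
    ext p
    simp [p.2]

theorem finrank_sym (N : ℕ) : Module.finrank ℝ (Sym N) = (N + 1).choose 2 := by
  rw [(upperEquiv N).finrank_eq, Module.finrank_pi]
  have h : Fintype.card {p : Fin N × Fin N // p.1 ≤ p.2} = Fintype.card (Sym2 (Fin N)) :=
    (Fintype.card_congr Sym2.sortEquiv).symm
  rw [h, Sym2.card, Fintype.card_fin]

/-- Each index lies in `N + 1` of the factors, counting the diagonal pair twice. -/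
theorem prod_upper_pairs (d : Fin N → ℝ) :
    ∏ p : {p : Fin N × Fin N // p.1 ≤ p.2}, d p.1.1 * d p.1.2 = (∏ i, d i) ^ (N + 1) := by
  have h1 : ∏ p : {p : Fin N × Fin N // p.1 ≤ p.2}, d p.1.1 * d p.1.2 =
      ∏ p : Fin N × Fin N, if p.1 ≤ p.2 then d p.1 * d p.2 else 1 := by
    rw [← Finset.prod_filter]
    exact (Finset.prod_subtype (Finset.univ.filter fun p : Fin N × Fin N => p.1 ≤ p.2)
      (by simp) (fun p => d p.1 * d p.2)).symm
  have h2 : ∏ p : Fin N × Fin N, (if p.1 ≤ p.2 then d p.1 * d p.2 else 1) =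
      ∏ p : Fin N × Fin N, d p.1 * (if p.1 = p.2 then d p.1 else 1) := by
    have h3 : ∀ p : Fin N × Fin N, (if p.1 ≤ p.2 then d p.1 * d p.2 else 1) =
        (if p.1 ≤ p.2 then d p.1 else 1) * (if p.1 ≤ p.2 then d p.2 else 1) := by
      intro p; split_ifs <;> simp
    simp_rw [h3]
    rw [Finset.prod_mul_distrib]
    have h4 : ∏ p : Fin N × Fin N, (if p.1 ≤ p.2 then d p.2 else 1) =
        ∏ p : Fin N × Fin N, (if p.2 ≤ p.1 then d p.1 else 1) :=
      Fintype.prod_equiv (Equiv.prodComm _ _) _ _ (fun p => by simp; rfl)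
    rw [h4, ← Finset.prod_mul_distrib]
    refine Finset.prod_congr rfl fun p _ => ?_
    rcases lt_trichotomy p.1 p.2 with h | h | h
    · simp [h.le, h.not_ge, h.ne]
    · simp [h]
    · simp [h.le, h.not_ge, h.ne']
  rw [h1, h2, Finset.prod_mul_distrib, Fintype.prod_prod_type, Fintype.prod_prod_type]
  simp [Finset.prod_pow, pow_succ]

theorem det_congruence_diagonal (d : Fin N → ℝ) :
    LinearMap.det (congruence (Matrix.diagonal d)) = (∏ i, d i) ^ (N + 1) := by
  rw [← prod_upper_pairs, ← LinearMap.det_conj _ (upperEquiv N), ← Matrix.det_diagonal,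
    ← LinearMap.det_toLin']
  congr 1
  refine LinearMap.ext fun f => ?_
  ext p
  obtain ⟨X, rfl⟩ := (upperEquiv N).surjective f
  simp [upperEquiv, Matrix.mul_diagonal, Matrix.mulVec_diagonal, p.2]
  ring

/-- The congruence by a symmetric matrix `C` scales volume on `Sym N` by `det C ^ (N + 1)`. -/
theorem det_congruence (C : Sym N) :
    LinearMap.det (congruence (toMat C)) = (toMat C).det ^ (N + 1) := by
  obtain ⟨U, h1, h2, h3⟩ := exists_diagonalization C
  have h4 : LinearMap.det (congruence U) * LinearMap.det (congruence U.transpose) = 1 := by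
    rw [← LinearMap.det_comp, ← congruence_mul, h1, congruence_one, LinearMap.det_id]
  have h5 : U.det * U.transpose.det = 1 := by rw [← Matrix.det_mul, h1, Matrix.det_one]
  rw [h3, congruence_mul, congruence_mul, LinearMap.det_comp, LinearMap.det_comp,
    det_congruence_diagonal, Matrix.det_mul, Matrix.det_mul, Matrix.det_diagonal]
  rw [mul_right_comm, h4, one_mul, mul_right_comm, h5, one_mul]

/-! ### The positive semidefinite cone -/

theorem exists_diagonalization_affine (X : Sym N) :
    ∃ U : Matrix (Fin N) (Fin N) ℝ, U * U.transpose = 1 ∧ U.transpose * U = 1 ∧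
      ∀ a b : ℝ, a • 1 + b • toMat X =
        U * Matrix.diagonal (fun i => a + b * eig X i) * U.transpose := by
  obtain ⟨U, h1, h2, h3⟩ := exists_diagonalization X
  refine ⟨U, h1, h2, fun a b => ?_⟩
  have : Matrix.diagonal (fun i => a + b * eig X i) =
      a • (1 : Matrix (Fin N) (Fin N) ℝ) + b • Matrix.diagonal (eig X) := by
    ext i j
    by_cases h : i = j <;> simp [h]
  rw [this, Matrix.mul_add, Matrix.add_mul]
  simp only [Matrix.mul_smul, Matrix.smul_mul, Matrix.mul_one, h1]
  rw [← h3]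

theorem det_smul_one_add (X : Sym N) (a b : ℝ) :
    (a • 1 + b • toMat X).det = ∏ i, (a + b * eig X i) := by
  obtain ⟨U, h1, h2, h3⟩ := exists_diagonalization_affine X
  have h5 : U.det * U.transpose.det = 1 := by rw [← Matrix.det_mul, h1, Matrix.det_one]
  rw [h3, Matrix.det_mul, Matrix.det_mul, Matrix.det_diagonal, mul_right_comm, h5, one_mul]

theorem posDef_smul_one_add_iff (X : Sym N) (a b : ℝ) :
    (a • 1 + b • toMat X).PosDef ↔ ∀ i, 0 < a + b * eig X i := by
  obtain ⟨U, h1, h2, h3⟩ := exists_diagonalization_affine X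
  have hU : IsUnit U := ⟨⟨U, U.transpose, h1, h2⟩, rfl⟩
  rw [h3, ← Matrix.posDef_diagonal_iff, ← Matrix.conjTranspose_eq_transpose_of_trivial,
    ← Matrix.star_eq_conjTranspose, Matrix.IsUnit.posDef_star_right_conjugate_iff hU]

theorem trace_eq_sum_eig (X : Sym N) : (toMat X).trace = ∑ i, eig X i := by
  obtain ⟨U, h1, h2, h3⟩ := exists_diagonalization X
  conv_lhs => rw [h3]
  rw [Matrix.trace_mul_comm, ← Matrix.mul_assoc, h2, Matrix.one_mul, Matrix.trace_diagonal]

theorem sum_eig_sq (X : Sym N) : ∑ i, eig X i ^ 2 = ‖X‖ ^ 2 := by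
  obtain ⟨U, h1, h2, h3⟩ := exists_diagonalization X
  rw [norm_sq_eq_trace]
  have : toMat X * toMat X =
      U * (Matrix.diagonal (eig X) * Matrix.diagonal (eig X)) * U.transpose := by
    conv_lhs => rw [h3]
    calc _ = U * Matrix.diagonal (eig X) * (U.transpose * U) * Matrix.diagonal (eig X) *
        U.transpose := by simp only [Matrix.mul_assoc]
      _ = _ := by rw [h2, Matrix.mul_one]; simp only [Matrix.mul_assoc]
  rw [this, Matrix.trace_mul_comm, ← Matrix.mul_assoc, h2, Matrix.one_mul,
    Matrix.diagonal_mul_diagonal, Matrix.trace_diagonal]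
  simp [sq]

theorem abs_eig_le_norm (X : Sym N) (i : Fin N) : |eig X i| ≤ ‖X‖ := by
  refine abs_le_of_sq_le_sq ?_ (norm_nonneg _)
  rw [← sum_eig_sq]
  exact Finset.single_le_sum (f := fun i => eig X i ^ 2) (fun i _ => sq_nonneg _)
    (Finset.mem_univ i)

theorem eig_nonneg {X : Sym N} (hX : (toMat X).PosSemidef) (i : Fin N) : 0 ≤ eig X i :=
  hX.eigenvalues_nonneg i

theorem norm_le_trace {X : Sym N} (hX : (toMat X).PosSemidef) : ‖X‖ ≤ (toMat X).trace := by
  rw [trace_eq_sum_eig]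
  refine le_of_abs_le (abs_le_of_sq_le_sq ?_ (Finset.sum_nonneg fun i _ => eig_nonneg hX i))
  rw [← sum_eig_sq]
  exact Finset.sum_sq_le_sq_sum_of_nonneg fun i _ => eig_nonneg hX i

/-- The cone of positive semidefinite matrices. -/
def psdCone (N : ℕ) : Set (Sym N) := {Q | (toMat Q).PosSemidef}

theorem isClosed_psdCone : IsClosed (psdCone N) := by
  have : psdCone N = ⋂ v : Fin N → ℝ, {Q : Sym N | 0 ≤ v ⬝ᵥ (toMat Q).mulVec v} := by
    ext Q
    simp only [psdCone, Set.mem_ofPred_eq, Set.mem_iInter]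
    rw [Matrix.posSemidef_iff_dotProduct_mulVec]
    simp only [toMat_isHermitian, true_and, star_trivial]
  rw [this]
  refine isClosed_iInter fun v => isClosed_le continuous_const ?_
  exact continuous_const.dotProduct (continuous_toMat.matrix_mulVec continuous_const)

theorem convex_psdCone : Convex ℝ (psdCone N) := by
  intro X hX Y hY a b ha hb _
  simp only [psdCone, Set.mem_ofPred_eq, toMat_add, toMat_smul] at *
  exact (hX.smul ha).add (hY.smul hb)

theorem measurableSet_psdCone : MeasurableSet (psdCone N) := isClosed_psdCone.measurableSet

/-- Positive definite matrices have positive definite symmetric square roots. -/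
theorem exists_sqrt {Y : Matrix (Fin N) (Fin N) ℝ} (hY : Y.PosDef) :
    ∃ C : Sym N, (toMat C).PosDef ∧ toMat C * toMat C = Y ∧ toMat C = CFC.sqrt Y := by
  have h1 : (CFC.sqrt Y).PosSemidef := Matrix.nonneg_iff_posSemidef.mp (CFC.sqrt_nonneg Y)
  have h2 : CFC.sqrt Y * CFC.sqrt Y = Y := CFC.sqrt_mul_sqrt_self Y hY.posSemidef.nonneg
  have h3 := h1.isHermitian
  rw [Matrix.IsHermitian, Matrix.conjTranspose_eq_transpose_of_trivial] at h3
  refine ⟨ofMat _ h3, ?_, h2, rfl⟩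
  rw [toMat_ofMat, h1.posDef_iff_det_ne_zero]
  intro h
  have := hY.det_pos
  rw [← h2, Matrix.det_mul, h, mul_zero] at this
  exact lt_irrefl _ this

theorem isUnit_det_of_posDef {C : Matrix (Fin N) (Fin N) ℝ} (h : C.PosDef) : IsUnit C.det :=
  isUnit_iff_ne_zero.mpr h.det_pos.ne'

theorem posSemidef_congruence {C : Sym N} {X : Sym N} (hX : (toMat X).PosSemidef) :
    (toMat (congruence (toMat C) X)).PosSemidef := by
  rw [toMat_congruence, ← Matrix.conjTranspose_eq_transpose_of_trivial]
  exact hX.mul_mul_conjTranspose_same _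

theorem posDef_congruence_iff {C : Sym N} (hC : (toMat C).PosDef) {X : Sym N} :
    (toMat (congruence (toMat C) X)).PosDef ↔ (toMat X).PosDef := by
  rw [toMat_congruence, ← Matrix.conjTranspose_eq_transpose_of_trivial,
    ← Matrix.star_eq_conjTranspose, Matrix.IsUnit.posDef_star_right_conjugate_iff hC.isUnit]

theorem posSemidef_congruence_iff {C : Sym N} (hC : (toMat C).PosDef) {X : Sym N} :
    (toMat (congruence (toMat C) X)).PosSemidef ↔ (toMat X).PosSemidef := by
  rw [toMat_congruence, ← Matrix.conjTranspose_eq_transpose_of_trivial,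
    ← Matrix.star_eq_conjTranspose, Matrix.IsUnit.posSemidef_star_right_conjugate_iff hC.isUnit]

theorem posDef_one_add {Z : Sym N} (hZ : ‖Z‖ < 1) : (1 + toMat Z).PosDef := by
  have := (posDef_smul_one_add_iff Z 1 1).mpr fun i => by
    have := (abs_le.mp (abs_eig_le_norm Z i)).1
    linarith
  simpa using this

theorem congruence_inv_cancel {C : Matrix (Fin N) (Fin N) ℝ} (hC : IsUnit C.det) (X : Sym N) :
    congruence C (congruence C⁻¹ X) = X := by
  rw [← LinearMap.comp_apply, ← congruence_mul, Matrix.mul_nonsing_inv _ hC, congruence_one,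
    LinearMap.id_apply]

theorem isOpen_posDef : IsOpen {Q : Sym N | (toMat Q).PosDef} := by
  rw [isOpen_iff_mem_nhds]
  intro Q hQ
  obtain ⟨C, hC, hCC, -⟩ := exists_sqrt hQ
  have hcont : Continuous fun X : Sym N => ‖congruence (toMat C)⁻¹ (X - Q)‖ :=
    (((congruence (toMat C)⁻¹).continuous_of_finiteDimensional).comp
      (continuous_id.sub continuous_const)).norm
  have hmem : {X : Sym N | ‖congruence (toMat C)⁻¹ (X - Q)‖ < 1} ∈ nhds Q :=
    (isOpen_lt hcont continuous_const).mem_nhds (by simp)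
  filter_upwards [hmem] with X hX
  have h1 := posDef_one_add hX
  have h2 : X = congruence (toMat C) (ofMat 1 (by simp) + congruence (toMat C)⁻¹ (X - Q)) := by
    rw [map_add, congruence_inv_cancel (isUnit_det_of_posDef hC)]
    have : congruence (toMat C) (ofMat 1 (by simp)) = Q :=
      toMat_injective (by simp [toMat_transpose, hCC])
    rw [this]; abel
  rw [h2, posDef_congruence_iff hC, toMat_add]
  exact h1

/-- A linear slice of the positive semidefinite cone through a positive definite matrix meets the
singular matrices in a null set, since these lie on the frontier of the slice. -/
theorem ae_slice_posSemidef_imp_posDef {E : Type*} [NormedAddCommGroup E] [NormedSpace ℝ E]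
    [FiniteDimensional ℝ E] [MeasurableSpace E] [BorelSpace E] (μ : Measure E)
    [μ.IsAddHaarMeasure] (j : E →ₗ[ℝ] Sym N) {P : Sym N} (hP : (toMat P).PosDef) :
    ∀ᵐ x ∂μ, (toMat (P + j x)).PosSemidef → (toMat (P + j x)).PosDef := by
  set s : Set E := {x | (toMat (P + j x)).PosSemidef} with hs
  have hconv : Convex ℝ s := by
    intro x hx y hy a b ha hb hab
    have : P + j (a • x + b • y) = a • (P + j x) + b • (P + j y) := by
      rw [map_add, map_smul, map_smul, smul_add, smul_add]
      nth_rw 1 [← one_smul ℝ P]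
      rw [← hab, add_smul]
      abel
    change P + j (a • x + b • y) ∈ psdCone N
    rw [this]
    exact convex_psdCone hx hy ha hb hab
  have hnull := hconv.addHaar_frontier μ
  rw [ae_iff]
  refine measure_mono_null ?_ hnull
  intro x hx
  simp only [Classical.not_imp, Set.mem_ofPred_eq] at hx
  refine ⟨subset_closure hx.1, fun hint => hx.2 ?_⟩
  -- slightly beyond `x` the slice is still semidefinite, and `x` is a proper convex combination
  -- of that point and the definite point over the origin
  have hnear : ∀ᶠ t : ℝ in nhds 1, t • x ∈ s := by
    have hc : Filter.Tendsto (fun t : ℝ => t • x) (nhds 1) (nhds ((1 : ℝ) • x)) :=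
      (continuous_id.smul continuous_const).tendsto _
    rw [one_smul] at hc
    filter_upwards [hc (isOpen_interior.mem_nhds hint)] with t ht
    exact interior_subset ht
  obtain ⟨t, ht, ht1⟩ := (hnear.filter_mono nhdsWithin_le_nhds |>.and
    (self_mem_nhdsWithin : Set.Ioi (1 : ℝ) ∈ nhdsWithin 1 (Set.Ioi 1))).exists
  have ht1 : 1 < t := ht1
  have ht0 : 0 < t := by linarith
  have key : P + j x = (1 - t⁻¹) • P + t⁻¹ • (P + j (t • x)) := by
    rw [map_smul, smul_add, smul_smul, inv_mul_cancel₀ ht0.ne', one_smul, sub_smul, one_smul]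
    abel
  rw [key, toMat_add, toMat_smul, toMat_smul]
  have h3 : t⁻¹ < 1 := inv_lt_one_of_one_lt₀ ht1
  exact (hP.smul (by linarith)).add_posSemidef (Matrix.PosSemidef.smul ht (by positivity))

theorem ae_posSemidef_imp_posDef :
    ∀ᵐ Q : Sym N, (toMat Q).PosSemidef → (toMat Q).PosDef := by
  have hone : (toMat (ofMat 1 (by simp) : Sym N)).PosDef := by
    rw [toMat_ofMat]; exact Matrix.PosDef.one
  have h := ae_slice_posSemidef_imp_posDef (volume : Measure (Sym N)) LinearMap.id hone
  have h2 := (measurePreserving_add_left volume (-(ofMat 1 (by simp) : Sym N)))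
  have := h2.quasiMeasurePreserving.ae h
  filter_upwards [this] with Q hQ
  simpa using hQ

/-! ### The Laplace transform of the cone on a complex strip -/

theorem integrable_exp_neg_mul_norm {E : Type*} [NormedAddCommGroup E] [NormedSpace ℝ E]
    [FiniteDimensional ℝ E] [MeasurableSpace E] [BorelSpace E] (μ : Measure E)
    [μ.IsAddHaarMeasure] {c : ℝ} (hc : 0 < c) :
    Integrable (fun x : E => Real.exp (-(c * ‖x‖))) μ := by
  set k := Module.finrank ℝ E + 1 with hk
  have h1 : Integrable (fun x : E => (1 + ‖x‖) ^ (-(k : ℝ))) μ :=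
    integrable_one_add_norm (by simp [hk])
  refine (h1.const_mul (Real.exp c * k.factorial / c ^ k)).mono'
    (by fun_prop) (Filter.Eventually.of_forall fun x => ?_)
  have hx : 0 < 1 + ‖x‖ := by positivity
  rw [Real.norm_of_nonneg (Real.exp_pos _).le, Real.rpow_neg hx.le, Real.rpow_natCast]
  have h2 := Real.pow_div_factorial_le_exp (c * (1 + ‖x‖)) (by positivity) k
  have h3 : Real.exp (c * (1 + ‖x‖)) = Real.exp c / Real.exp (-(c * ‖x‖)) := by
    rw [← Real.exp_sub]; congr 1; ring
  rw [h3, mul_pow, le_div_iff₀ (Real.exp_pos _)] at h2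
  have h4 : 0 < c ^ k * (1 + ‖x‖) ^ k / k.factorial := by positivity
  calc Real.exp (-(c * ‖x‖)) = (c ^ k * (1 + ‖x‖) ^ k / k.factorial * Real.exp (-(c * ‖x‖))) /
      (c ^ k * (1 + ‖x‖) ^ k / k.factorial) := by field_simp
    _ ≤ Real.exp c / (c ^ k * (1 + ‖x‖) ^ k / k.factorial) := by gcongr
    _ = _ := by field_simp

theorem integral_comp_linearMap {E F : Type*} [NormedAddCommGroup E] [NormedSpace ℝ E]
    [FiniteDimensional ℝ E] [MeasurableSpace E] [BorelSpace E] [NormedAddCommGroup F]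
    [NormedSpace ℝ F] (μ : Measure E) [μ.IsAddHaarMeasure] {L : E →ₗ[ℝ] E}
    (hL : LinearMap.det L ≠ 0) (f : E → F) :
    ∫ x, f (L x) ∂μ = |LinearMap.det L|⁻¹ • ∫ x, f x ∂μ := by
  have he := Measure.map_linearMap_addHaar_eq_smul_addHaar μ hL
  have h := ((L.equivOfDetNeZero hL).toContinuousLinearEquiv.toHomeomorph.measurableEmbedding
    ).integral_map (μ := μ) f
  have h2 : ⇑(L.equivOfDetNeZero hL).toContinuousLinearEquiv.toHomeomorph = ⇑L := rfl
  rw [h2, he, integral_smul_measure, ENNReal.toReal_ofReal (abs_nonneg _), abs_inv] at h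
  exact h.symm

theorem trace_mul_eq_trace_congruence {C : Sym N} (Q : Sym N) :
    (toMat C * toMat C * toMat Q).trace = (toMat (congruence (toMat C) Q)).trace := by
  rw [toMat_congruence, toMat_transpose, Matrix.mul_assoc, Matrix.trace_mul_comm]

/-- The linear functional of a positive definite matrix is coercive on the semidefinite cone. -/
theorem exists_norm_le_trace_mul {Y : Matrix (Fin N) (Fin N) ℝ} (hY : Y.PosDef) :
    ∃ c > 0, ∀ Q ∈ psdCone N, c * ‖Q‖ ≤ (Y * toMat Q).trace := by
  obtain ⟨C, hC, rfl, -⟩ := exists_sqrt hY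
  set L := LinearMap.toContinuousLinearMap (congruence (toMat C)⁻¹) with hL
  refine ⟨(1 + ‖L‖)⁻¹, by positivity, fun Q hQ => ?_⟩
  rw [trace_mul_eq_trace_congruence, inv_mul_le_iff₀ (by positivity)]
  have h1 := norm_le_trace (posSemidef_congruence (C := C) hQ)
  have h2 : L (congruence (toMat C) Q) = Q := by
    change congruence (toMat C)⁻¹ (congruence (toMat C) Q) = Q
    rw [← LinearMap.comp_apply, ← congruence_mul,
      Matrix.nonsing_inv_mul _ (isUnit_det_of_posDef hC), congruence_one, LinearMap.id_apply]
  calc ‖Q‖ = ‖L (congruence (toMat C) Q)‖ := by rw [h2]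
    _ ≤ ‖L‖ * ‖congruence (toMat C) Q‖ := L.le_opNorm _
    _ ≤ (1 + ‖L‖) * _ := by gcongr; linarith

theorem continuous_trace_mul (Y : Matrix (Fin N) (Fin N) ℝ) :
    Continuous fun Q : Sym N => (Y * toMat Q).trace :=
  (continuous_const.matrix_mul continuous_toMat).matrix_trace

theorem integrableOn_exp_neg_trace {Y : Matrix (Fin N) (Fin N) ℝ} (hY : Y.PosDef) :
    IntegrableOn (fun Q : Sym N => Real.exp (-(Y * toMat Q).trace)) (psdCone N) := by
  obtain ⟨c, hc, h⟩ := exists_norm_le_trace_mul hY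
  refine (integrable_exp_neg_mul_norm volume hc).integrableOn.mono'
    (Real.continuous_exp.comp (continuous_trace_mul Y).neg).aestronglyMeasurable ?_
  filter_upwards [ae_restrict_mem measurableSet_psdCone] with Q hQ
  rw [Real.norm_of_nonneg (Real.exp_pos _).le]
  exact Real.exp_le_exp.mpr (neg_le_neg (h Q hQ))

/-- At `(N + 1) / 2` the determinant has exponent zero, and the singular matrices are negligible. -/
theorem multivariateGamma_eq : multivariateGamma N (((N : ℝ) + 1) / 2) =
    ∫ Q in psdCone N, Real.exp (-(toMat Q).trace) := by
  rw [multivariateGamma]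
  simp only [sub_self, Real.rpow_zero, mul_one]
  refine setIntegral_congr_set ?_
  filter_upwards [ae_posSemidef_imp_posDef (N := N)] with Q hQ
  exact propext ⟨fun h => h.posSemidef, hQ⟩

/-- The Laplace transform of the positive semidefinite cone. -/
theorem integral_exp_neg_trace {Y : Matrix (Fin N) (Fin N) ℝ} (hY : Y.PosDef) :
    ∫ Q in psdCone N, Real.exp (-(Y * toMat Q).trace) =
      multivariateGamma N (((N : ℝ) + 1) / 2) * Y.det ^ (-(((N : ℝ) + 1) / 2)) := by
  obtain ⟨C, hC, rfl, -⟩ := exists_sqrt hY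
  have hdet := hC.det_pos
  have h1 := integral_comp_linearMap (volume : Measure (Sym N)) (L := congruence (toMat C))
    (by rw [det_congruence]; positivity)
    ((psdCone N).indicator fun Q => Real.exp (-(toMat Q).trace))
  rw [integral_indicator measurableSet_psdCone, ← multivariateGamma_eq] at h1
  have h2 : (fun Q => (psdCone N).indicator (fun Q => Real.exp (-(toMat Q).trace))
      (congruence (toMat C) Q)) =
      (psdCone N).indicator fun Q => Real.exp (-(toMat C * toMat C * toMat Q).trace) := by
    ext Q
    by_cases hQ : Q ∈ psdCone N
    · have : congruence (toMat C) Q ∈ psdCone N := posSemidef_congruence hQ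
      rw [Set.indicator_of_mem hQ, Set.indicator_of_mem this, trace_mul_eq_trace_congruence]
    · have : congruence (toMat C) Q ∉ psdCone N :=
        fun h => hQ ((posSemidef_congruence_iff hC).mp h)
      rw [Set.indicator_of_notMem hQ, Set.indicator_of_notMem this]
  rw [h2, integral_indicator measurableSet_psdCone] at h1
  rw [h1, det_congruence, abs_of_pos (by positivity), smul_eq_mul, mul_comm, Matrix.det_mul, ← sq,
    ← Real.rpow_natCast, ← Real.rpow_natCast, ← Real.rpow_mul hdet.le, ← Real.rpow_neg hdet.le]
  congr 2
  push_cast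
  ring

theorem multivariateGamma_pos : 0 < multivariateGamma N (((N : ℝ) + 1) / 2) := by
  rw [multivariateGamma_eq]
  have hi := integrableOn_exp_neg_trace (N := N) Matrix.PosDef.one
  simp only [Matrix.one_mul] at hi
  rw [setIntegral_pos_iff_support_of_nonneg_ae
    (Filter.Eventually.of_forall fun _ => (Real.exp_pos _).le) hi]
  have : Function.support (fun Q : Sym N => Real.exp (-(toMat Q).trace)) = Set.univ := by
    ext Q; simp [(Real.exp_pos _).ne']
  rw [this, Set.univ_inter]
  refine lt_of_lt_of_le (IsOpen.measure_pos volume isOpen_posDef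
    ⟨ofMat 1 (by simp), ?_⟩) (measure_mono fun Q hQ => Matrix.PosDef.posSemidef hQ)
  change (toMat (ofMat 1 _)).PosDef
  rw [toMat_ofMat]
  exact Matrix.PosDef.one

/-- The factor `∏ j, (1 - z λ j / n) ^ (-n)` in terms of the eigenvalues `λ` of `T`. -/
noncomputable def charFactor (n : ℝ) (T : Sym N) (z : ℂ) : ℂ :=
  Complex.exp (-n * ∑ j, Complex.log (1 - z * eig T j / n))

theorem charFactor_ofReal {n t : ℝ} {T : Sym N} (h : ∀ j, 0 < 1 - t * eig T j / n) :
    charFactor n T t = ((∏ j, (1 - t * eig T j / n)) ^ (-n) : ℝ) := by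
  rw [charFactor, ← Real.finsetProd_rpow _ _ (fun j _ => (h j).le), Complex.ofReal_prod,
    Finset.mul_sum, Complex.exp_sum]
  refine Finset.prod_congr rfl fun j _ => ?_
  rw [Complex.ofReal_cpow (h j).le, Complex.cpow_def_of_ne_zero (by exact_mod_cast (h j).ne')]
  push_cast
  congr 1; ring

theorem strip_pos {n r : ℝ} {T : Sym N} (hn : 0 < n) (hr : |r| < n / (1 + ‖T‖)) (j : Fin N) :
    0 < 1 - r * eig T j / n := by
  have h1 : |r * eig T j| < n := by
    rw [abs_mul]
    calc |r| * |eig T j| ≤ |r| * (1 + ‖T‖) := by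
          gcongr
          have := abs_eig_le_norm T j
          linarith
      _ < n := (lt_div_iff₀ (by positivity)).mp hr
  have h2 : r * eig T j / n < 1 := (div_lt_one hn).mpr (abs_lt.mp h1).2
  linarith

/-- The complex Laplace transform of the exponential distribution on the semidefinite cone, on a
strip. It agrees with the asserted formula on the real axis, where it is the value at
`n P⁻¹ - t ξ` of the Laplace transform of the cone, and both sides are analytic. -/
theorem integral_cexp_strip {S : Sym N} (hS : (toMat S).PosDef) (ξ : Sym N) {n : ℝ}
    (hn : n = ((N : ℝ) + 1) / 2) {z : ℂ}
    (hz : |z.re| < n / (1 + ‖congruence (toMat S) ξ‖)) :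
    ∫ Q in psdCone N, Real.exp (-(n * ((toMat S * toMat S)⁻¹ * toMat Q).trace)) •
        Complex.exp (z * (inner ℝ ξ Q : ℝ)) =
      ((multivariateGamma N n * ((n • (toMat S * toMat S)⁻¹).det) ^ (-n) : ℝ) : ℂ) *
        charFactor n (congruence (toMat S) ξ) z := by
  have hn0 : 0 < n := by rw [hn]; positivity
  set T := congruence (toMat S) ξ with hT
  set δ := n / (1 + ‖T‖) with hδ
  have hδ0 : 0 < δ := by positivity
  have hP : (toMat S * toMat S).PosDef := by
    have := (posDef_congruence_iff hS (X := ofMat 1 (by simp))).mpr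
      (by rw [toMat_ofMat]; exact Matrix.PosDef.one)
    simpa [toMat_transpose] using this
  set P := toMat S * toMat S with hPdef
  have hSu := isUnit_det_of_posDef hS
  -- the matrix `n P⁻¹ - t ξ` is congruent to `n - t T`
  have hcongr : ∀ t : ℝ, n • P⁻¹ - t • toMat ξ =
      (toMat S)⁻¹ * (n • 1 + (-t) • toMat T) * (toMat S)⁻¹ := by
    intro t
    have h1 : (toMat S)⁻¹ * toMat T * (toMat S)⁻¹ = toMat ξ := by
      rw [hT, toMat_congruence, toMat_transpose]
      calc _ = ((toMat S)⁻¹ * toMat S) * toMat ξ * (toMat S * (toMat S)⁻¹) := by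
            simp only [Matrix.mul_assoc]
        _ = _ := by rw [Matrix.nonsing_inv_mul _ hSu, Matrix.mul_nonsing_inv _ hSu]; simp
    rw [Matrix.mul_add, Matrix.add_mul]
    simp only [Matrix.mul_smul, Matrix.smul_mul, Matrix.mul_one, h1]
    rw [hPdef, Matrix.mul_inv_rev, neg_smul, sub_eq_add_neg]
  have hpd : ∀ t : ℝ, |t| < δ → (n • P⁻¹ - t • toMat ξ).PosDef := by
    intro t ht
    rw [hcongr]
    have h1 : (n • 1 + (-t) • toMat T).PosDef := by
      rw [posDef_smul_one_add_iff]
      intro i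
      have := strip_pos hn0 ht i
      have h2 : n + -t * eig T i = n * (1 - t * eig T i / n) := by field_simp; ring
      rw [h2]; positivity
    have hSi : star (toMat S)⁻¹ = (toMat S)⁻¹ := by
      rw [Matrix.star_eq_conjTranspose, Matrix.conjTranspose_eq_transpose_of_trivial,
        Matrix.transpose_nonsing_inv, toMat_transpose]
    nth_rewrite 2 [← hSi]
    rw [Matrix.IsUnit.posDef_star_right_conjugate_iff]
    · exact h1
    · exact Matrix.isUnit_nonsing_inv_iff.mpr hS.isUnit
  have hdet : ∀ t : ℝ, (n • P⁻¹ - t • toMat ξ).det =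
      (n • P⁻¹).det * ∏ j, (1 - t * eig T j / n) := by
    intro t
    have h0 := hcongr 0
    rw [zero_smul, sub_zero, neg_zero, zero_smul, add_zero] at h0
    rw [hcongr t, h0, Matrix.det_mul, Matrix.det_mul, det_smul_one_add, Matrix.det_mul,
      Matrix.det_mul, Matrix.det_smul, Matrix.det_one, Fintype.card_fin, mul_one]
    have : ∏ i, (n + -t * eig T i) = n ^ N * ∏ j, (1 - t * eig T j / n) := by
      have hpow : n ^ N = ∏ _i : Fin N, n := by simp
      rw [hpow, ← Finset.prod_mul_distrib]
      refine Finset.prod_congr rfl fun i _ => ?_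
      field_simp; ring
    rw [this]; ring
  have htr : ∀ (t : ℝ) (Q : Sym N), Real.exp (-(n * (P⁻¹ * toMat Q).trace)) *
      Real.exp (t * inner ℝ ξ Q) = Real.exp (-((n • P⁻¹ - t • toMat ξ) * toMat Q).trace) := by
    intro t Q
    rw [← Real.exp_add, inner_eq_trace, Matrix.sub_mul, Matrix.trace_sub, Matrix.smul_mul,
      Matrix.smul_mul, Matrix.trace_smul, Matrix.trace_smul, smul_eq_mul, smul_eq_mul]
    congr 1; ring
  -- the exponential distribution on the cone, unnormalized
  set w : Sym N → NNReal := fun Q => ⟨Real.exp (-(n * (P⁻¹ * toMat Q).trace)), (Real.exp_pos _).le⟩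
    with hw
  have hwm : Measurable w := by
    refine Measurable.subtype_mk ?_
    exact (Real.continuous_exp.comp
      (continuous_const.mul (continuous_trace_mul P⁻¹)).neg).measurable
  set μ : Measure (Sym N) := (volume.restrict (psdCone N)).withDensity fun Q => (w Q : ENNReal)
    with hμ
  set X : Sym N → ℝ := fun Q => inner ℝ ξ Q with hX
  have hint : ∀ t : ℝ, |t| < δ → Integrable (fun Q => Real.exp (t * X Q)) μ := by
    intro t ht
    rw [hμ, integrable_withDensity_iff_integrable_smul hwm]
    refine (integrableOn_exp_neg_trace (hpd t ht)).congr
      (Filter.Eventually.of_forall fun Q => ?_)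
    exact (htr t Q).symm
  have hmgf : ∀ z : ℂ, ProbabilityTheory.complexMGF X μ z = ∫ Q in psdCone N,
      Real.exp (-(n * (P⁻¹ * toMat Q).trace)) • Complex.exp (z * (inner ℝ ξ Q : ℝ)) := by
    intro z
    rw [ProbabilityTheory.complexMGF, hμ, integral_withDensity_eq_integral_smul hwm]
    rfl
  have hreal : ∀ t : ℝ, |t| < δ → ProbabilityTheory.complexMGF X μ t =
      ((multivariateGamma N n * ((n • P⁻¹).det) ^ (-n) : ℝ) : ℂ) * charFactor n T t := by
    intro t ht
    have hpos := strip_pos hn0 ht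
    have hdP : 0 < (n • P⁻¹).det := (hP.inv.smul hn0).det_pos
    rw [ProbabilityTheory.complexMGF_ofReal, ProbabilityTheory.mgf, hμ,
      integral_withDensity_eq_integral_smul hwm, charFactor_ofReal hpos,
      ← Complex.ofReal_mul, mul_assoc, ← Real.mul_rpow hdP.le
        (Finset.prod_nonneg fun j _ => (hpos j).le), ← hdet]
    congr 1
    have := integral_exp_neg_trace (hpd t ht)
    rw [← hn] at this
    rw [← this]
    refine integral_congr_ae (Filter.Eventually.of_forall fun Q => ?_)
    exact htr t Q
  have hsub : Set.Ioo (-δ) δ ⊆ interior (ProbabilityTheory.integrableExpSet X μ) :=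
    interior_maximal (fun t ht => hint t (abs_lt.mpr ht)) isOpen_Ioo
  set U : Set ℂ := {z | z.re ∈ Set.Ioo (-δ) δ} with hU
  have hUo : IsOpen U := isOpen_Ioo.preimage Complex.continuous_re
  have hUc : IsPreconnected U :=
    ((convex_Ioo (-δ) δ).linear_preimage Complex.reLm).isPreconnected
  have hf : AnalyticOnNhd ℂ (ProbabilityTheory.complexMGF X μ) U :=
    ProbabilityTheory.analyticOnNhd_complexMGF.mono fun z hz => hsub hz
  have hg : AnalyticOnNhd ℂ (fun z => ((multivariateGamma N n * ((n • P⁻¹).det) ^ (-n) : ℝ) : ℂ) *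
      charFactor n T z) U := by
    refine DifferentiableOn.analyticOnNhd (fun z hz => ?_) hUo
    refine DifferentiableAt.differentiableWithinAt ?_
    unfold charFactor
    refine (DifferentiableAt.cexp (DifferentiableAt.const_mul
      (DifferentiableAt.fun_sum fun j _ => DifferentiableAt.clog (by fun_prop) ?_) _)).const_mul _
    left
    have := strip_pos hn0 (abs_lt.mpr hz) j
    have h2 : (1 - z * eig T j / n : ℂ).re = 1 - z.re * eig T j / n := by
      rw [Complex.sub_re, Complex.one_re, Complex.div_ofReal_re, Complex.re_mul_ofReal]
    rwa [h2]
  have h0U : (0 : ℂ) ∈ U := by simp [hU, hδ0]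
  have key := hf.eqOn_of_preconnected_of_frequently_eq hg hUc h0U (by
    have hlim : Filter.Tendsto (fun t : ℝ => (t : ℂ)) (nhdsWithin 0 {0}ᶜ)
        (nhdsWithin 0 {0}ᶜ) := by
      refine tendsto_nhdsWithin_iff.mpr ⟨?_, ?_⟩
      · exact (Complex.continuous_ofReal.tendsto' 0 0 (by simp)).mono_left nhdsWithin_le_nhds
      · filter_upwards [self_mem_nhdsWithin] with t ht
        simpa using ht
    refine hlim.frequently (Filter.Eventually.frequently ?_)
    have : Set.Ioo (-δ) δ ∈ nhdsWithin (0 : ℝ) {0}ᶜ :=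
      mem_nhdsWithin_of_mem_nhds (isOpen_Ioo.mem_nhds (by simp [hδ0]))
    filter_upwards [this] with t ht
    exact hreal t (abs_lt.mpr ht))
  rw [← hmgf]
  exact key (abs_lt.mp hz)

/-! ### Fourier inversion on slices -/

theorem measurePreserving_add_orthogonal {E : Type*} [NormedAddCommGroup E]
    [InnerProductSpace ℝ E] [FiniteDimensional ℝ E] [MeasurableSpace E] [BorelSpace E]
    (K : Submodule ℝ E) :
    MeasurePreserving (fun p : K × Kᗮ => (p.1 : E) + (p.2 : E)) :=
  (K.orthogonalDecomposition.symm.measurePreserving).comp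
    (WithLp.volume_preserving_toLp K Kᗮ)

theorem measurableEmbedding_add_orthogonal {E : Type*} [NormedAddCommGroup E]
    [InnerProductSpace ℝ E] [FiniteDimensional ℝ E] [MeasurableSpace E] [BorelSpace E]
    (K : Submodule ℝ E) :
    MeasurableEmbedding (fun p : K × Kᗮ => (p.1 : E) + (p.2 : E)) :=
  (K.orthogonalDecomposition.symm.toHomeomorph.measurableEmbedding).comp
    (MeasurableEquiv.toLp 2 (K × Kᗮ)).measurableEmbedding

theorem integrable_slice {E : Type*} [NormedAddCommGroup E]
    [InnerProductSpace ℝ E] [FiniteDimensional ℝ E] [MeasurableSpace E] [BorelSpace E]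
    (K : Submodule ℝ E) {h : E → ℂ} (hh : Integrable h) :
    Integrable fun w : Kᗮ => ∫ x : K, h (x + w) :=
  Integrable.integral_prod_right (μ := (volume : Measure K)) (ν := (volume : Measure Kᗮ))
    (((measurePreserving_add_orthogonal K).integrable_comp_emb
      (measurableEmbedding_add_orthogonal K)).mpr hh)

open FourierTransform in
/-- The Fourier transform of the integrals over the slices parallel to `K` is the restriction of
the Fourier transform to the orthogonal complement of `K`. -/
theorem fourier_slice {E : Type*} [NormedAddCommGroup E]
    [InnerProductSpace ℝ E] [FiniteDimensional ℝ E] [MeasurableSpace E] [BorelSpace E]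
    (K : Submodule ℝ E) {h : E → ℂ} (hh : Integrable h) (ξ : Kᗮ) :
    𝓕 (fun w : Kᗮ => ∫ x : K, h (x + w)) ξ =
      ∫ y, h y * Complex.exp ((-2 * Real.pi * Complex.I) * (inner ℝ (ξ : E) y : ℝ)) := by
  set H : E → ℂ := fun y => h y * Complex.exp ((-2 * Real.pi * Complex.I) * (inner ℝ (ξ : E) y : ℝ))
    with hH
  have hHi : Integrable H := by
    refine hh.mul_bdd (c := 1) (by fun_prop) (Filter.Eventually.of_forall fun y => ?_)
    rw [Complex.norm_exp]
    simp
  have h1 : Integrable (fun p : K × Kᗮ => H (p.1 + p.2))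
      ((volume : Measure K).prod (volume : Measure Kᗮ)) :=
    ((measurePreserving_add_orthogonal K).integrable_comp_emb
      (measurableEmbedding_add_orthogonal K)).mpr hHi
  have h2 := (measurePreserving_add_orthogonal K).integral_comp
    (measurableEmbedding_add_orthogonal K) H
  rw [← h2, Measure.volume_eq_prod, integral_prod_symm _ h1, Real.fourier_eq']
  refine integral_congr_ae (Filter.Eventually.of_forall fun w => ?_)
  simp only [hH]
  have h3 : ∀ x : K, inner ℝ (ξ : E) ((x : E) + w) = inner ℝ w ξ := by
    intro x
    rw [inner_add_right, Submodule.inner_left_of_mem_orthogonal x.2 ξ.2, zero_add,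
      real_inner_comm]
    rfl
  simp_rw [h3]
  rw [integral_mul_const, smul_eq_mul, mul_comm]
  congr 2
  push_cast
  ring

open FourierTransform in
/-- Fourier inversion for slices: the integral of `h` over `K` is the integral of the Fourier
transform of `h` over the orthogonal complement of `K`. -/
theorem integral_slice_eq {E : Type*} [NormedAddCommGroup E]
    [InnerProductSpace ℝ E] [FiniteDimensional ℝ E] [MeasurableSpace E] [BorelSpace E]
    (K : Submodule ℝ E) {h : E → ℂ} (hh : Integrable h)
    (hcont : ContinuousAt (fun w : Kᗮ => ∫ x : K, h (x + w)) 0) {b : Kᗮ → ℝ} (hb : Integrable b)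
    (hbound : ∀ ξ : Kᗮ,
      ‖∫ y, h y * Complex.exp ((-2 * Real.pi * Complex.I) * (inner ℝ (ξ : E) y : ℝ))‖ ≤ b ξ) :
    ∫ x : K, h x = ∫ ξ : Kᗮ, ∫ y, h y *
        Complex.exp ((-2 * Real.pi * Complex.I) * (inner ℝ (ξ : E) y : ℝ)) ∧
      AEStronglyMeasurable (fun ξ : Kᗮ => ∫ y, h y *
        Complex.exp ((-2 * Real.pi * Complex.I) * (inner ℝ (ξ : E) y : ℝ))) := by
  set g : Kᗮ → ℂ := fun w => ∫ x : K, h (x + w) with hg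
  have hgi : Integrable g := integrable_slice K hh
  have hF : 𝓕 g = fun ξ : Kᗮ => ∫ y, h y *
        Complex.exp ((-2 * Real.pi * Complex.I) * (inner ℝ (ξ : E) y : ℝ)) :=
    funext fun ξ => fourier_slice K hh ξ
  have hm : AEStronglyMeasurable (𝓕 g) :=
    (VectorFourier.fourierIntegral_continuous Real.continuous_fourierChar
      continuous_inner hgi).aestronglyMeasurable
  have hFi : Integrable (𝓕 g) := by
    refine hb.mono' hm (Filter.Eventually.of_forall fun ξ => ?_)
    rw [hF]
    exact hbound ξ
  have key := hgi.fourierInv_fourier_eq hFi hcont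
  rw [Real.fourierInv_eq'] at key
  refine ⟨?_, hF ▸ hm⟩
  rw [← hF]
  simp only [inner_zero_right, mul_zero, Complex.ofReal_zero, zero_mul, Complex.exp_zero, one_smul,
    hg, Submodule.coe_zero, add_zero] at key
  exact key.symm

/-! ### Radial moments and the integrated error term -/

theorem pow_mul_rpow_le {r n : ℝ} (hr : 0 ≤ r) (k : ℕ) :
    r ^ k * (1 + r ^ 2) ^ (-n / 2) ≤ (1 + r ^ 2) ^ (-(n - k) / 2) := by
  have h1 : (0 : ℝ) < 1 + r ^ 2 := by positivity
  have h2 : r ^ k ≤ (1 + r ^ 2) ^ ((k : ℝ) / 2) := by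
    calc r ^ k = (r ^ 2) ^ ((k : ℝ) / 2) := by
          rw [← Real.rpow_natCast r 2, ← Real.rpow_mul hr, ← Real.rpow_natCast]
          congr 1; push_cast; ring
      _ ≤ _ := by gcongr; linarith
  calc _ ≤ (1 + r ^ 2) ^ ((k : ℝ) / 2) * (1 + r ^ 2) ^ (-n / 2) := by gcongr
    _ = _ := by rw [← Real.rpow_add h1]; congr 1; ring

section
variable {V : Type*} [NormedAddCommGroup V] [InnerProductSpace ℝ V] [FiniteDimensional ℝ V]
  [MeasurableSpace V] [BorelSpace V]

theorem integrable_norm_pow_mul_rpow {n : ℝ} {k : ℕ} (h : (Module.finrank ℝ V : ℝ) + k < n) :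
    Integrable fun v : V => ‖v‖ ^ k * (1 + ‖v‖ ^ 2) ^ (-n / 2) := by
  refine (integrable_rpow_neg_one_add_norm_sq (μ := (volume : Measure V)) (r := n - k)
    (by linarith)).mono' ?_ (Filter.Eventually.of_forall fun v => ?_)
  · refine Continuous.aestronglyMeasurable ?_
    refine (continuous_norm.pow k).mul (Continuous.rpow_const (by fun_prop) fun v => Or.inl ?_)
    positivity
  · rw [Real.norm_of_nonneg (by positivity)]
    exact pow_mul_rpow_le (norm_nonneg v) k

end

/-- Integration by parts for the radial integrals. -/
theorem integral_Ioi_pow_mul_rpow {n : ℝ} {k : ℕ} (h : (k : ℝ) + 3 < n) :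
    (n - k - 3) * ∫ r in Set.Ioi (0 : ℝ), r ^ (k + 2) * (1 + r ^ 2) ^ (-n / 2) =
      (k + 1) * ∫ r in Set.Ioi (0 : ℝ), r ^ k * (1 + r ^ 2) ^ (-n / 2) := by
  have hint : ∀ j : ℕ, (j : ℝ) + 1 < n →
      IntegrableOn (fun r : ℝ => r ^ j * (1 + r ^ 2) ^ (-n / 2)) (Set.Ioi 0) := by
    intro j hj
    have := integrable_norm_pow_mul_rpow (V := ℝ) (n := n) (k := j) (by simp; linarith)
    refine this.integrableOn.congr_fun (fun r hr => ?_) measurableSet_Ioi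
    simp only [Real.norm_of_nonneg (le_of_lt (Set.mem_Ioi.mp hr))]
  have hi1 := (hint (k + 2) (by push_cast; linarith)).const_mul (n - k - 3)
  have hi2 := (hint k (by linarith)).const_mul ((k : ℝ) + 1)
  have hderiv : ∀ r ∈ Set.Ici (0 : ℝ), HasDerivAt
      (fun r : ℝ => r ^ (k + 1) * (1 + r ^ 2) ^ (1 - n / 2))
      (((k : ℝ) + 1) * (r ^ k * (1 + r ^ 2) ^ (-n / 2)) -
        (n - k - 3) * (r ^ (k + 2) * (1 + r ^ 2) ^ (-n / 2))) r := by
    intro r _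
    have hpos : (0 : ℝ) < 1 + r ^ 2 := by positivity
    have h1 : HasDerivAt (fun r : ℝ => r ^ (k + 1)) (((k : ℝ) + 1) * r ^ k) r := by
      simpa using hasDerivAt_pow (k + 1) r
    have h2 : HasDerivAt (fun r : ℝ => 1 + r ^ 2) (2 * r) r := by
      simpa using (hasDerivAt_pow 2 r).const_add 1
    have h3 := h2.rpow_const (p := 1 - n / 2) (Or.inl hpos.ne')
    convert! h1.mul h3 using 1
    have e1 : (1 + r ^ 2) ^ (1 - n / 2) = (1 + r ^ 2) * (1 + r ^ 2) ^ (-n / 2) := by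
      nth_rewrite 2 [← Real.rpow_one (1 + r ^ 2)]
      rw [← Real.rpow_add hpos]; congr 1; ring
    have e2 : 1 - n / 2 - 1 = -n / 2 := by ring
    rw [e1, e2]
    ring
  have hlim : Filter.Tendsto (fun r : ℝ => r ^ (k + 1) * (1 + r ^ 2) ^ (1 - n / 2))
      Filter.atTop (nhds 0) := by
    have hup : Filter.Tendsto (fun r : ℝ => (1 + r ^ 2) ^ (-((n - k - 3) / 2)))
        Filter.atTop (nhds 0) := by
      refine (tendsto_rpow_neg_atTop (by linarith)).comp ?_
      exact Filter.tendsto_atTop_add_const_left _ _ (Filter.tendsto_pow_atTop two_ne_zero)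
    refine tendsto_of_tendsto_of_tendsto_of_le_of_le' tendsto_const_nhds hup ?_ ?_
    · filter_upwards [Filter.eventually_ge_atTop 0] with r hr
      positivity
    · filter_upwards [Filter.eventually_ge_atTop 0] with r hr
      have := pow_mul_rpow_le (n := n - 2) hr (k + 1)
      convert! this using 2
      · ring_nf
      · push_cast; ring
  have := integral_Ioi_of_hasDerivAt_of_tendsto' hderiv (hi2.sub hi1) hlim
  rw [integral_sub hi2 hi1, integral_const_mul, integral_const_mul] at this
  simp only [ne_eq, Nat.add_eq_zero_iff, one_ne_zero, and_false, not_false_eq_true, zero_pow,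
    zero_mul, sub_zero] at this
  linarith

section
variable {V : Type*} [NormedAddCommGroup V] [InnerProductSpace ℝ V] [FiniteDimensional ℝ V]
  [MeasurableSpace V] [BorelSpace V]

/-- The even radial moments of the weight `(1 + |v|²) ^ (-n / 2)` satisfy a first order recursion:
in polar coordinates this is the integration by parts. -/
theorem integral_norm_pow_mul_rpow [Nontrivial V] {n : ℝ} {k : ℕ}
    (h : (Module.finrank ℝ V : ℝ) + k + 2 < n) :
    (n - Module.finrank ℝ V - k - 2) * ∫ v : V, ‖v‖ ^ (k + 2) * (1 + ‖v‖ ^ 2) ^ (-n / 2) =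
      (Module.finrank ℝ V + k) * ∫ v : V, ‖v‖ ^ k * (1 + ‖v‖ ^ 2) ^ (-n / 2) := by
  obtain ⟨d, hd⟩ : ∃ d, Module.finrank ℝ V = d + 1 :=
    Nat.exists_eq_succ_of_ne_zero Module.finrank_pos.ne'
  have hpolar : ∀ j : ℕ, ∫ v : V, ‖v‖ ^ j * (1 + ‖v‖ ^ 2) ^ (-n / 2) =
      (Module.finrank ℝ V * (volume : Measure V).real (Metric.ball 0 1)) *
        ∫ r in Set.Ioi (0 : ℝ), r ^ (d + j) * (1 + r ^ 2) ^ (-n / 2) := by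
    intro j
    have := integral_fun_norm_addHaar (volume : Measure V)
      (fun r : ℝ => r ^ j * (1 + r ^ 2) ^ (-n / 2))
    rw [this, nsmul_eq_mul, smul_eq_mul, mul_assoc]
    simp only [hd, Nat.add_sub_cancel, smul_eq_mul, ← mul_assoc, ← pow_add]
  have hJ := integral_Ioi_pow_mul_rpow (n := n) (k := d + k) (by
    rw [hd] at h; push_cast at h ⊢; linarith)
  rw [hpolar, hpolar, ← add_assoc]
  rw [hd]
  push_cast at hJ ⊢
  linear_combination ((d + 1 : ℝ) * (volume : Measure V).real (Metric.ball 0 1)) * hJ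

theorem integrable_exp_neg_mul_sq_norm {c : ℝ} (hc : 0 < c) :
    Integrable fun v : V => Real.exp (-c * ‖v‖ ^ 2) := by
  have h := GaussianFourier.integrable_cexp_neg_mul_sq_norm_add (b := (c : ℂ)) (by simpa) 0 (0 : V)
  refine h.re.congr (Filter.Eventually.of_forall fun v => ?_)
  simp only [zero_mul, add_zero]
  rw [← Complex.ofReal_pow, ← Complex.ofReal_neg, ← Complex.ofReal_mul, ← Complex.ofReal_exp]
  rfl

theorem integral_exp_neg_half_mul_sq_norm {n : ℝ} (hn : 0 < n) :
    ∫ v : V, Real.exp (-(n / 2) * ‖v‖ ^ 2) =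
      (2 * Real.pi / n) ^ ((Module.finrank ℝ V : ℝ) / 2) := by
  rw [GaussianFourier.integral_rexp_neg_mul_sq_norm (by positivity : 0 < n / 2)]
  congr 1
  field_simp

/-- The weight `(1 + s) ^ (-n / 2)` exceeds its Gaussian approximation by little, because
`log (1 + s) ≥ s - s² / 2`. -/
theorem rpow_sub_exp_le {n s : ℝ} (hn : 0 ≤ n) (hs : 0 ≤ s) :
    (1 + s) ^ (-n / 2) - Real.exp (-(n / 2) * s) ≤ n / 4 * (s ^ 2 * (1 + s) ^ (-n / 2)) := by
  have h1 : 0 < 1 + s := by linarith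
  have hlog : s - s ^ 2 / 2 ≤ Real.log (1 + s) := by
    have h := Real.le_log_one_add_of_nonneg hs
    refine le_trans ?_ h
    rw [le_div_iff₀ (by linarith)]
    nlinarith [pow_nonneg hs 3]
  rw [Real.rpow_def_of_pos h1]
  set L := Real.log (1 + s)
  have h2 : Real.exp (-(n / 2) * s) = Real.exp (L * (-n / 2)) * Real.exp (n / 2 * (L - s)) := by
    rw [← Real.exp_add]; congr 1; ring
  have h3 := Real.add_one_le_exp (n / 2 * (L - s))
  have h4 : 1 - n / 4 * s ^ 2 ≤ Real.exp (n / 2 * (L - s)) := by nlinarith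
  have h5 := Real.exp_pos (L * (-n / 2))
  rw [h2]
  nlinarith

/-- The error term of the Gaussian approximation, integrated. The second and fourth radial moments
of the weight `(1 + |v|²) ^ (-n / 2)` are explicit multiples of its mass, and the mass is
compared with the Gaussian one through the fourth moment. -/
theorem integral_error_le [Nontrivial V] {n : ℝ}
    (hn : 1000 * (Module.finrank ℝ V : ℝ) ^ 2 ≤ n) :
    ∫ v : V, n / 3 * (‖v‖ ^ 3 * (1 + ‖v‖ ^ 2) ^ (-n / 2)) ≤
      (Module.finrank ℝ V : ℝ) * √((Module.finrank ℝ V : ℝ) / n) *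
        (2 * Real.pi / n) ^ ((Module.finrank ℝ V : ℝ) / 2) := by
  have hm1 : (1 : ℝ) ≤ Module.finrank ℝ V := by exact_mod_cast Module.finrank_pos (R := ℝ) (M := V)
  set m : ℝ := (Module.finrank ℝ V : ℝ) with hm
  have hmn : 1000 * m ≤ n := by nlinarith
  have hn0 : 0 < n := by linarith
  set I : ℕ → ℝ := fun k => ∫ v : V, ‖v‖ ^ k * (1 + ‖v‖ ^ 2) ^ (-n / 2) with hI
  have hint : ∀ k : ℕ, (k : ℝ) ≤ 4 → Integrable
      fun v : V => ‖v‖ ^ k * (1 + ‖v‖ ^ 2) ^ (-n / 2) := fun k hk =>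
    integrable_norm_pow_mul_rpow (by rw [← hm]; linarith)
  have hI0 : 0 ≤ I 0 := integral_nonneg fun v => by positivity
  have h2 : (n - m - 2) * I 2 = m * I 0 := by
    have := integral_norm_pow_mul_rpow (V := V) (n := n) (k := 0)
      (by rw [← hm]; push_cast; linarith)
    rw [← hm] at this
    simpa [hI] using this
  have h4 : (n - m - 4) * I 4 = (m + 2) * I 2 := by
    have := integral_norm_pow_mul_rpow (V := V) (n := n) (k := 2)
      (by rw [← hm]; push_cast; linarith)
    rw [← hm] at this
    simp only [hI]
    push_cast at this
    linear_combination this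
  have hI2n : 0 ≤ I 2 := integral_nonneg fun v => by positivity
  have hI4n : 0 ≤ I 4 := integral_nonneg fun v => by positivity
  have hI2 : n * I 2 ≤ 1.01 * (m * I 0) := by nlinarith
  have hI4 : n * I 4 ≤ 3.1 * (m * I 2) := by nlinarith
  have hI4' : n ^ 2 * I 4 ≤ 3.2 * (m ^ 2 * I 0) := by
    have : n * (n * I 4) ≤ 3.1 * (m * (n * I 2)) := by nlinarith
    nlinarith
  -- the total mass against the Gaussian mass
  have hG : ∫ v : V, Real.exp (-(n / 2) * ‖v‖ ^ 2) = (2 * Real.pi / n) ^ (m / 2) :=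
    integral_exp_neg_half_mul_sq_norm hn0
  set G := ∫ v : V, Real.exp (-(n / 2) * ‖v‖ ^ 2) with hGdef
  have hGi : Integrable fun v : V => Real.exp (-(n / 2) * ‖v‖ ^ 2) :=
    integrable_exp_neg_mul_sq_norm (by positivity)
  have hcomp : I 0 - G ≤ n / 4 * I 4 := by
    have h0 := hint 0 (by norm_num)
    have h4 := hint 4 (by norm_num)
    rw [hI, hGdef]
    simp only
    rw [← integral_sub h0 hGi, ← integral_const_mul]
    refine integral_mono (h0.sub hGi) (h4.const_mul _) fun v => ?_
    have := rpow_sub_exp_le hn0.le (sq_nonneg ‖v‖)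
    simp only [pow_zero, one_mul]
    rw [← pow_mul] at this
    exact this
  have hI0G : I 0 ≤ 1.01 * G := by
    have : n * (n / 4 * I 4) ≤ 0.8 * (m ^ 2 * I 0) := by nlinarith
    have h3 : n * (I 0 - G) ≤ 0.8 * (m ^ 2 * I 0) :=
      (mul_le_mul_of_nonneg_left hcomp hn0.le).trans this
    have h5 : m ^ 2 * I 0 ≤ n / 1000 * I 0 := by
      apply mul_le_mul_of_nonneg_right _ hI0; linarith
    have h6 : n * (I 0 - G) ≤ n * (0.8 / 1000 * I 0) := by linarith
    have h7 := le_of_mul_le_mul_left h6 hn0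
    linarith
  -- `|v|³ ≤ (α |v|² + |v|⁴ / α) / 2` with `α² = m / n`
  set α := √(m / n) with hα
  have hα0 : 0 < α := Real.sqrt_pos.mpr (by positivity)
  have hαsq : n * α ^ 2 = m := by rw [hα, Real.sq_sqrt (by positivity)]; field_simp
  have hcube : ∫ v : V, n / 3 * (‖v‖ ^ 3 * (1 + ‖v‖ ^ 2) ^ (-n / 2)) ≤
      n / 6 * (α * I 2 + α⁻¹ * I 4) := by
    have i2 := (hint 2 (by norm_num)).const_mul α
    have i4 := (hint 4 (by norm_num)).const_mul α⁻¹
    have : n / 6 * (α * I 2 + α⁻¹ * I 4) = ∫ v : V, n / 6 *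
        (α * (‖v‖ ^ 2 * (1 + ‖v‖ ^ 2) ^ (-n / 2)) +
          α⁻¹ * (‖v‖ ^ 4 * (1 + ‖v‖ ^ 2) ^ (-n / 2))) := by
      rw [integral_const_mul, integral_add i2 i4, integral_const_mul, integral_const_mul]
    rw [this]
    refine integral_mono ((hint 3 (by norm_num)).const_mul _) ((i2.add i4).const_mul _) fun v => ?_
    have hw : 0 ≤ (1 + ‖v‖ ^ 2) ^ (-n / 2) := by positivity
    have hx : 2 * ‖v‖ ^ 3 ≤ α * ‖v‖ ^ 2 + α⁻¹ * ‖v‖ ^ 4 := by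
      have : α * ‖v‖ ^ 2 + α⁻¹ * ‖v‖ ^ 4 - 2 * ‖v‖ ^ 3 = α⁻¹ * (‖v‖ * (α - ‖v‖)) ^ 2 := by
        field_simp; ring
      have h9 : 0 ≤ α⁻¹ * (‖v‖ * (α - ‖v‖)) ^ 2 := by positivity
      linarith
    have hx2 := mul_le_mul_of_nonneg_right hx hw
    have hn6 : 0 ≤ n / 6 := by positivity
    have := mul_le_mul_of_nonneg_left hx2 hn6
    calc _ = n / 6 * (2 * ‖v‖ ^ 3 * (1 + ‖v‖ ^ 2) ^ (-n / 2)) := by ring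
      _ ≤ _ := this
      _ = _ := by ring
  refine hcube.trans ?_
  rw [← hG]
  have e1 : n / 6 * (α * I 2) ≤ 0.17 * (m * α * I 0) := by nlinarith
  have e2 : n / 6 * (α⁻¹ * I 4) ≤ 0.54 * (m * α * I 0) := by
    have : n / 6 * (α⁻¹ * I 4) = α / m / 6 * (n ^ 2 * I 4) := by
      rw [← hαsq]; field_simp
    rw [this]
    calc _ ≤ α / m / 6 * (3.2 * (m ^ 2 * I 0)) := by gcongr
      _ = 3.2 / 6 * (m * α * I 0) := by field_simp
      _ ≤ _ := by
        have : 0 ≤ m * α * I 0 := by positivity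
        nlinarith
  calc n / 6 * (α * I 2 + α⁻¹ * I 4) ≤ 0.71 * (m * α * I 0) := by linarith
    _ ≤ 0.71 * (m * α * (1.01 * G)) := by gcongr
    _ ≤ m * α * G := by
      have : 0 ≤ m * α * G := by
        have : 0 ≤ G := by linarith
        positivity
      nlinarith

end

/-! ### The characteristic function against the Gaussian -/

/-- The third order remainder of `log (1 + i x)`, uniformly on the real line. -/
theorem norm_log_one_add_mul_I_sub_le (x : ℝ) :
    ‖Complex.log (1 + x * Complex.I) - x * Complex.I - (x : ℂ) ^ 2 / 2‖ ≤ |x| ^ 3 / 3 := by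
  have hslit : ∀ t : ℝ, (1 + (t * x : ℝ) * Complex.I : ℂ) ∈ Complex.slitPlane := by
    intro t; left; simp
  set f : ℝ → ℂ := fun t => Complex.log (1 + (t * x : ℝ) * Complex.I) - (t * x : ℝ) * Complex.I -
    ((t * x : ℝ) : ℂ) ^ 2 / 2 with hf
  have hderiv : ∀ t : ℝ, HasDerivAt f
      (-(Complex.I * t ^ 2 * x ^ 3) / (1 + (t * x : ℝ) * Complex.I)) t := by
    intro t
    have h0 : HasDerivAt (fun t : ℝ => ((t * x : ℝ) : ℂ)) (x : ℂ) t :=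
      HasDerivAt.ofReal_comp (by simpa using (hasDerivAt_id t).mul_const x)
    have h1 : HasDerivAt (fun t : ℝ => ((t * x : ℝ) : ℂ) * Complex.I) (x * Complex.I) t :=
      h0.mul_const _
    have h2 := (h1.const_add 1).clog_real (hslit t)
    have h3 := (h0.pow 2).div_const 2
    convert! (h2.sub h1).sub h3 using 1
    have hne := Complex.slitPlane_ne_zero (hslit t)
    push_cast at hne ⊢
    rw [div_eq_iff hne, sub_mul, sub_mul, div_mul_cancel₀ _ hne]
    linear_combination ((t : ℂ) * x ^ 2) * Complex.I_sq
  have hB : ∀ t : ℝ, HasDerivAt (fun t : ℝ => t ^ 3 * (|x| ^ 3 / 3)) (t ^ 2 * |x| ^ 3) t := by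
    intro t
    convert! (hasDerivAt_pow 3 t).mul_const (|x| ^ 3 / 3) using 1
    push_cast; ring
  have := image_norm_le_of_norm_deriv_right_le_deriv_boundary (a := 0) (b := 1) (f := f)
    (fun t _ => (hderiv t).continuousAt.continuousWithinAt)
    (fun t _ => (hderiv t).hasDerivWithinAt) (by simp [hf]) hB (fun t _ => by
      rw [norm_div, norm_neg]
      have h1 : 1 ≤ ‖(1 + (t * x : ℝ) * Complex.I : ℂ)‖ := by
        refine le_trans ?_ (Complex.abs_re_le_norm _)
        simp
      have h2 : ‖Complex.I * (t : ℂ) ^ 2 * (x : ℂ) ^ 3‖ = t ^ 2 * |x| ^ 3 := by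
        simp
      rw [h2]
      exact div_le_self (by positivity) h1) (Set.right_mem_Icc.mpr zero_le_one)
  simpa [hf] using this

theorem norm_cexp_sub_cexp_le {a b : ℂ} {M : ℝ} (ha : a.re ≤ M) (hb : b.re ≤ M) :
    ‖Complex.exp a - Complex.exp b‖ ≤ Real.exp M * ‖a - b‖ := by
  refine (convex_halfSpace_re_le M).norm_image_sub_le_of_norm_deriv_le (𝕜 := ℂ)
    (f := Complex.exp) (fun z _ => Complex.differentiableAt_exp) (fun z hz => ?_) hb ha
  rw [Complex.deriv_exp, Complex.norm_exp]
  exact Real.exp_le_exp.mpr hz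

theorem one_add_sum_le_prod {ι : Type*} (s : Finset ι) {f : ι → ℝ} (hf : ∀ i, 0 ≤ f i) :
    1 + ∑ i ∈ s, f i ≤ ∏ i ∈ s, (1 + f i) := by
  classical
  induction s using Finset.induction_on with
  | empty => simp
  | insert a s ha ih =>
    rw [Finset.sum_insert ha, Finset.prod_insert ha]
    have h1 := Finset.sum_nonneg fun i (_ : i ∈ s) => hf i
    have h2 := mul_le_mul_of_nonneg_left ih (show 0 ≤ 1 + f a by linarith [hf a])
    nlinarith [mul_nonneg (hf a) h1]

/-- The normalized characteristic function is pointwise close to the Gaussian one: the exponents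
differ by the cubic Taylor remainders, and both functions are bounded by
`(1 + ρ²) ^ (-n / 2)`. -/
theorem norm_charFactor_sub_le {n : ℝ} (hn : 0 < n) (T : Sym N) {ρ : ℝ}
    (hρ : ρ = 2 * Real.pi / n * ‖T‖) :
    ‖charFactor n T (-2 * Real.pi * Complex.I) *
        Complex.exp (2 * Real.pi * Complex.I * ((toMat T).trace : ℝ)) -
        (Real.exp (-(n / 2) * ρ ^ 2) : ℝ)‖ ≤ n / 3 * (ρ ^ 3 * (1 + ρ ^ 2) ^ (-n / 2)) := by
  set x : Fin N → ℝ := fun j => 2 * Real.pi / n * eig T j with hx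
  have hρ0 : 0 ≤ ρ := by rw [hρ]; positivity
  have hsum : ∑ j, x j ^ 2 = ρ ^ 2 := by
    simp only [hx, mul_pow, ← Finset.mul_sum]
    rw [sum_eig_sq, hρ, mul_pow]
  have hxρ : ∀ j, |x j| ≤ ρ := fun j => by
    refine abs_le_of_sq_le_sq ?_ hρ0
    rw [← hsum]
    exact Finset.single_le_sum (f := fun i => x i ^ 2) (fun i _ => sq_nonneg _) (Finset.mem_univ j)
  set a : ℂ := ∑ j, -n * (Complex.log (1 + x j * Complex.I) - x j * Complex.I) with ha
  set b : ℂ := ((-(n / 2) * ρ ^ 2 : ℝ) : ℂ) with hb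
  have hfun : charFactor n T (-2 * Real.pi * Complex.I) *
      Complex.exp (2 * Real.pi * Complex.I * ((toMat T).trace : ℝ)) = Complex.exp a := by
    rw [charFactor, ← Complex.exp_add, trace_eq_sum_eig, Complex.ofReal_sum, Finset.mul_sum,
      Finset.mul_sum, ← Finset.sum_add_distrib, ha]
    congr 1
    refine Finset.sum_congr rfl fun j _ => ?_
    have e1 : (1 - -2 * Real.pi * Complex.I * eig T j / n : ℂ) = 1 + x j * Complex.I := by
      simp only [hx]; push_cast; ring
    have hn' : (n : ℂ) ≠ 0 := by exact_mod_cast hn.ne'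
    have e2 : (2 * Real.pi * Complex.I * eig T j : ℂ) = n * (x j * Complex.I) := by
      simp only [hx]; push_cast; field_simp
    rw [e1, e2]; ring
  have hab : ‖a - b‖ ≤ n / 3 * ρ ^ 3 := by
    have e : a - b = ∑ j, -n * (Complex.log (1 + x j * Complex.I) - x j * Complex.I -
        (x j : ℂ) ^ 2 / 2) := by
      rw [ha, hb, ← hsum, Complex.ofReal_mul, Complex.ofReal_sum, Finset.mul_sum,
        ← Finset.sum_sub_distrib]
      refine Finset.sum_congr rfl fun j _ => ?_
      push_cast; ring
    rw [e]
    calc _ ≤ ∑ j, n * (|x j| ^ 3 / 3) := by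
          refine norm_sum_le_of_le _ fun j _ => ?_
          rw [norm_mul, norm_neg, Complex.norm_real, Real.norm_of_nonneg hn.le]
          exact mul_le_mul_of_nonneg_left (norm_log_one_add_mul_I_sub_le _) hn.le
      _ ≤ ∑ j, n / 3 * ρ * x j ^ 2 := by
          refine Finset.sum_le_sum fun j _ => ?_
          have : |x j| ^ 3 ≤ ρ * x j ^ 2 := by
            rw [pow_succ', sq_abs]
            exact mul_le_mul_of_nonneg_right (hxρ j) (sq_nonneg _)
          nlinarith
      _ = _ := by rw [← Finset.mul_sum, hsum]; ring
  have hpos : (0 : ℝ) < 1 + ρ ^ 2 := by positivity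
  have hlog : Real.log (1 + ρ ^ 2) ≤ ∑ j, Real.log (1 + x j ^ 2) := by
    rw [← Real.log_prod (fun j _ => by positivity), ← hsum]
    refine Real.log_le_log (by rw [hsum]; exact hpos) ?_
    exact one_add_sum_le_prod _ fun j => sq_nonneg _
  have hare : a.re ≤ Real.log (1 + ρ ^ 2) * (-n / 2) := by
    have e : a.re = -n / 2 * ∑ j, Real.log (1 + x j ^ 2) := by
      rw [ha, Complex.re_sum, Finset.mul_sum]
      refine Finset.sum_congr rfl fun j _ => ?_
      have h1 : ‖(1 + x j * Complex.I : ℂ)‖ = √(1 + x j ^ 2) := by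
        rw [← Complex.ofReal_one, Complex.norm_add_mul_I, one_pow]
      rw [← Complex.ofReal_neg, Complex.re_ofReal_mul, Complex.sub_re, Complex.log_re, h1,
        Real.log_sqrt (by positivity)]
      simp
      ring
    rw [e]
    nlinarith
  have hbre : b.re ≤ Real.log (1 + ρ ^ 2) * (-n / 2) := by
    rw [hb, Complex.ofReal_re]
    have := Real.log_le_sub_one_of_pos hpos
    nlinarith
  rw [hfun, Complex.ofReal_exp]
  refine (norm_cexp_sub_cexp_le hare hbre).trans ?_
  rw [← Real.rpow_def_of_pos hpos]
  calc _ ≤ (1 + ρ ^ 2) ^ (-n / 2) * (n / 3 * ρ ^ 3) := by gcongr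
    _ = _ := by ring

/-! ### Geometry of the spectrahedron and the entropy maximizer -/

variable {m : ℕ}

theorem opA_apply (A : Fin m → Sym N) (X : Sym N) (k : Fin m) :
    opA A X k = inner ℝ (A k) X := (inner_eq_trace _ _).symm

theorem ker_opA (A : Fin m → Sym N) :
    LinearMap.ker (opA A) = (Submodule.span ℝ (Set.range A))ᗮ := by
  ext X
  rw [LinearMap.mem_ker, Submodule.mem_orthogonal]
  constructor
  · intro h u hu
    induction hu using Submodule.span_induction with
    | mem u hu =>
      obtain ⟨k, rfl⟩ := hu
      rw [← opA_apply, h]; rfl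
    | zero => simp
    | add u v _ _ hu hv => rw [inner_add_left, hu, hv, add_zero]
    | smul c u _ hu => rw [real_inner_smul_left, hu, mul_zero]
  · intro h
    ext k
    rw [opA_apply]
    exact h _ (Submodule.subset_span ⟨k, rfl⟩)

theorem orthogonal_ker_opA (A : Fin m → Sym N) :
    (LinearMap.ker (opA A))ᗮ = Submodule.span ℝ (Set.range A) := by
  rw [ker_opA, Submodule.orthogonal_orthogonal]

theorem finrank_orthogonal_ker_opA {A : Fin m → Sym N} (hA : LinearIndependent ℝ A) :
    Module.finrank ℝ (LinearMap.ker (opA A))ᗮ = m := by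
  rw [orthogonal_ker_opA, finrank_span_eq_card hA, Fintype.card_fin]

theorem finrank_ker_opA {A : Fin m → Sym N} (hA : LinearIndependent ℝ A) :
    Module.finrank ℝ (LinearMap.ker (opA A)) = (N + 1).choose 2 - m := by
  have := (LinearMap.ker (opA A)).finrank_add_finrank_orthogonal
  rw [finrank_orthogonal_ker_opA hA, finrank_sym] at this
  omega

/-- The kernel of `opA A` is the direction of the affine subspace cut out by the equations. -/
theorem mem_spectrahedron_iff {A : Fin m → Sym N} {b : Fin m → ℝ} {P : Sym N}
    (hP : P ∈ spectrahedron A b) (X : Sym N) :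
    P + X ∈ spectrahedron A b ↔ (toMat (P + X)).PosSemidef ∧ X ∈ LinearMap.ker (opA A) := by
  refine and_congr_right fun _ => ?_
  have h1 : ∀ k, (toMat (A k) * toMat (P + X)).trace = b k + opA A X k := fun k => by
    rw [← inner_eq_trace, inner_add_right, opA_apply, inner_eq_trace, hP.2 k]
  rw [LinearMap.mem_ker]
  constructor
  · intro h
    ext k
    have := h k
    rw [h1] at this
    simpa using this
  · intro h k
    rw [h1, h]; simp

theorem sub_mem_ker {A : Fin m → Sym N} {b : Fin m → ℝ} {P Q : Sym N}
    (hP : P ∈ spectrahedron A b) (hQ : Q ∈ spectrahedron A b) :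
    Q - P ∈ LinearMap.ker (opA A) := by
  have := (mem_spectrahedron_iff hP (Q - P)).mp (by rwa [add_sub_cancel])
  exact this.2

theorem convex_spectrahedron (A : Fin m → Sym N) (b : Fin m → ℝ) :
    Convex ℝ (spectrahedron A b) := by
  intro X hX Y hY s t hs ht hst
  refine ⟨convex_psdCone hX.1 hY.1 hs ht hst, fun k => ?_⟩
  have h : ∀ Z, (toMat (A k) * toMat Z).trace = opA A Z k := fun _ => rfl
  have hX2 := hX.2 k
  have hY2 := hY.2 k
  rw [h] at hX2 hY2 ⊢
  rw [map_add, map_smul, map_smul, PiLp.add_apply, PiLp.smul_apply, PiLp.smul_apply, hX2, hY2,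
    ← add_smul, hst, one_smul]

/-- The symmetric matrix `v wᵀ + w vᵀ`, linearly in `w`. -/
def symProd (v : Fin N → ℝ) : (Fin N → ℝ) →ₗ[ℝ] Sym N where
  toFun w := ofMat (Matrix.vecMulVec v w + Matrix.vecMulVec w v) (by
    simp [Matrix.transpose_vecMulVec, add_comm])
  map_add' w₁ w₂ := toMat_injective (by
    simp only [toMat_add, toMat_ofMat, Matrix.vecMulVec_add, Matrix.add_vecMulVec]; abel)
  map_smul' c w := toMat_injective (by
    simp only [toMat_smul, toMat_ofMat, Matrix.vecMulVec_smul, Matrix.smul_vecMulVec, smul_add,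
      RingHom.id_apply])

theorem symProd_injective {v : Fin N → ℝ} (hv : v ≠ 0) : Function.Injective (symProd v) := by
  rw [← LinearMap.ker_eq_bot, LinearMap.ker_eq_bot']
  intro w hw
  obtain ⟨i, hi⟩ := Function.ne_iff.mp hv
  have h : ∀ j, v i * w j + w i * v j = 0 := fun j => by
    have := congrArg (fun X => toMat X i j) hw
    simpa [symProd, Matrix.vecMulVec_apply, toMat_zero] using this
  have hi' : v i ≠ 0 := hi
  have hwi : w i = 0 := by
    have h2 : v i * w i = 0 := by linarith [h i, mul_comm (w i) (v i)]
    exact (mul_eq_zero.mp h2).resolve_left hi'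
  ext j
  have := h j
  rw [hwi, zero_mul, add_zero] at this
  exact (mul_eq_zero.mp this).resolve_left hi'

theorem inner_symProd (X : Sym N) (v w : Fin N → ℝ) :
    inner ℝ X (symProd v w) = 2 * (w ⬝ᵥ (toMat X).mulVec v) := by
  rw [inner_eq_trace, symProd]
  simp only [LinearMap.coe_mk, AddHom.coe_mk, toMat_ofMat]
  rw [Matrix.mul_add, Matrix.trace_add, Matrix.mul_vecMulVec, Matrix.mul_vecMulVec,
    Matrix.trace_vecMulVec, Matrix.trace_vecMulVec]
  have : (toMat X).mulVec w ⬝ᵥ v = w ⬝ᵥ (toMat X).mulVec v := by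
    rw [dotProduct_comm, Matrix.dotProduct_mulVec, ← Matrix.mulVec_transpose, toMat_transpose,
      dotProduct_comm]
  rw [this, dotProduct_comm]
  ring

/-- A spectrahedron of the generic dimension, cut out by fewer than `N` equations, contains a
positive definite matrix. Otherwise the kernels of its members have a common nonzero vector `v`,
namely any kernel vector of a member with the smallest kernel; then the differences of members
annihilate `v`, and the orthogonal complement of their span contains the `N`-dimensional space of
the matrices `v wᵀ + w vᵀ`. -/
theorem exists_posDef_mem_spectrahedron {A : Fin m → Sym N} {b : Fin m → ℝ}
    (hA : LinearIndependent ℝ A) (hne : (spectrahedron A b).Nonempty) (hmN : m < N)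
    (hdim : Module.finrank ℝ (vectorSpan ℝ (spectrahedron A b)) = (N + 1).choose 2 - m) :
    ∃ P ∈ spectrahedron A b, (toMat P).PosDef := by
  by_contra! hcon
  obtain ⟨P, hP, hmin⟩ : ∃ P ∈ spectrahedron A b, ∀ Q ∈ spectrahedron A b,
      Module.finrank ℝ (LinearMap.ker (toMat P).mulVecLin) ≤
        Module.finrank ℝ (LinearMap.ker (toMat Q).mulVecLin) := by
    obtain ⟨P, hP, h⟩ := (measure fun Q : Sym N =>
      Module.finrank ℝ (LinearMap.ker (toMat Q).mulVecLin)).wf.has_min _ hne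
    exact ⟨P, hP, fun Q hQ => not_lt.mp (h Q hQ)⟩
  obtain ⟨v, hv, hPv⟩ : ∃ v ≠ 0, (toMat P).mulVec v = 0 := by
    have h1 := hcon P hP
    rw [hP.1.posDef_iff_det_ne_zero, not_not] at h1
    exact Matrix.exists_mulVec_eq_zero_iff.mpr h1
  have hcommon : ∀ Q ∈ spectrahedron A b, (toMat Q).mulVec v = 0 := by
    intro Q hQ
    set R := (1 / 2 : ℝ) • P + (1 / 2 : ℝ) • Q with hR
    have hRm : R ∈ spectrahedron A b :=
      convex_spectrahedron A b hP hQ (by norm_num) (by norm_num) (by norm_num)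
    have hker : ∀ u, (toMat R).mulVec u = 0 →
        (toMat P).mulVec u = 0 ∧ (toMat Q).mulVec u = 0 := by
      intro u hu
      have h1 := hP.1.dotProduct_mulVec_nonneg u
      have h2 := hQ.1.dotProduct_mulVec_nonneg u
      have h3 : star u ⬝ᵥ (toMat R).mulVec u = 0 := by rw [hu, dotProduct_zero]
      rw [hR, toMat_add, toMat_smul, toMat_smul, Matrix.add_mulVec, Matrix.smul_mulVec,
        Matrix.smul_mulVec, dotProduct_add, dotProduct_smul, dotProduct_smul, smul_eq_mul,
        smul_eq_mul] at h3
      exact ⟨(hP.1.dotProduct_mulVec_zero_iff u).mp (by linarith),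
        (hQ.1.dotProduct_mulVec_zero_iff u).mp (by linarith)⟩
    have hle : LinearMap.ker (toMat R).mulVecLin ≤ LinearMap.ker (toMat P).mulVecLin :=
      fun u hu => (hker u hu).1
    have heq := Submodule.eq_of_le_of_finrank_le hle (hmin R hRm)
    have hvR : v ∈ LinearMap.ker (toMat R).mulVecLin := by
      rw [heq]; exact hPv
    exact (hker v hvR).2
  have hspan : vectorSpan ℝ (spectrahedron A b) = LinearMap.ker (opA A) := by
    refine Submodule.eq_of_le_of_finrank_eq ?_ (by rw [hdim, finrank_ker_opA hA])
    rw [vectorSpan_def, Submodule.span_le]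
    rintro _ ⟨Q, hQ, R, hR, rfl⟩
    exact sub_mem_ker hR hQ
  have hkill : ∀ X ∈ LinearMap.ker (opA A), (toMat X).mulVec v = 0 := by
    intro X hX
    rw [← hspan, vectorSpan_def] at hX
    induction hX using Submodule.span_induction with
    | mem X hX =>
      obtain ⟨Q, hQ, R, hR, rfl⟩ := hX
      change (toMat (Q - R)).mulVec v = 0
      rw [toMat_sub, Matrix.sub_mulVec, hcommon Q hQ, hcommon R hR, sub_zero]
    | zero => rw [toMat_zero, Matrix.zero_mulVec]
    | add X Y _ _ hX hY => rw [toMat_add, Matrix.add_mulVec, hX, hY, add_zero]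
    | smul c X _ hX => rw [toMat_smul, Matrix.smul_mulVec, hX, smul_zero]
  have hrange : LinearMap.range (symProd v) ≤ (LinearMap.ker (opA A))ᗮ := by
    rintro _ ⟨w, rfl⟩
    rw [Submodule.mem_orthogonal]
    intro X hX
    rw [inner_symProd, hkill X hX, dotProduct_zero, mul_zero]
  have := Submodule.finrank_mono hrange
  rw [LinearMap.finrank_range_of_inj (symProd_injective hv), finrank_orthogonal_ker_opA hA,
    Module.finrank_fin_fun] at this
  omega

theorem entropy_le_entropy_iff {P Q : Sym N} (hP : (toMat P).PosDef) (hQ : (toMat Q).PosDef) :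
    entropy P ≤ entropy Q ↔ (toMat P).det ≤ (toMat Q).det := by
  rw [entropy, entropy, add_le_add_iff_left, mul_le_mul_iff_right₀ (by positivity),
    Real.log_le_log_iff hP.det_pos hQ.det_pos]

theorem exists_isEntropyMaximizer {A : Fin m → Sym N} {b : Fin m → ℝ}
    (hc : IsCompact (spectrahedron A b))
    (h : ∃ P ∈ spectrahedron A b, (toMat P).PosDef) : ∃ P, IsEntropyMaximizer A b P := by
  obtain ⟨P₀, hP₀, hd⟩ := h
  obtain ⟨P, hP, hmax⟩ := hc.exists_isMaxOn ⟨P₀, hP₀⟩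
    (continuous_toMat.matrix_det (n := Fin N)).continuousOn
  have hPd : (toMat P).PosDef := by
    rw [hP.1.posDef_iff_det_ne_zero]
    exact (hd.det_pos.trans_le (hmax hP₀)).ne'
  exact ⟨P, hP, hPd, fun Q hQ hQd => (entropy_le_entropy_iff hQd hPd).mpr (hmax hQ)⟩

theorem toMat_add_smul_congruence {S P : Sym N} (hS : (toMat S).PosDef)
    (hSP : toMat S * toMat S = toMat P) (X : Sym N) (t : ℝ) :
    toMat (P + t • X) = toMat S * ((1 : ℝ) • 1 + t • toMat (congruence (toMat S)⁻¹ X)) *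
      toMat S := by
  have h := congrArg toMat (congruence_inv_cancel (isUnit_det_of_posDef hS) X)
  rw [toMat_congruence, toMat_transpose] at h
  rw [toMat_add, toMat_smul, one_smul, Matrix.mul_add, Matrix.add_mul, Matrix.mul_one, hSP,
    Matrix.mul_smul, Matrix.smul_mul, h]

theorem det_add_smul {S P : Sym N} (hS : (toMat S).PosDef)
    (hSP : toMat S * toMat S = toMat P) (X : Sym N) (t : ℝ) :
    (toMat (P + t • X)).det =
      (toMat P).det * ∏ j, (1 + t * eig (congruence (toMat S)⁻¹ X) j) := by
  rw [toMat_add_smul_congruence hS hSP, Matrix.det_mul, Matrix.det_mul, det_smul_one_add, ← hSP,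
    Matrix.det_mul]
  ring

theorem posDef_add_smul_iff {S P : Sym N} (hS : (toMat S).PosDef)
    (hSP : toMat S * toMat S = toMat P) (X : Sym N) (t : ℝ) :
    (toMat (P + t • X)).PosDef ↔ ∀ j, 0 < 1 + t * eig (congruence (toMat S)⁻¹ X) j := by
  rw [toMat_add_smul_congruence hS hSP, ← posDef_smul_one_add_iff]
  have h : star (toMat S) = toMat S := by
    rw [Matrix.star_eq_conjTranspose, (toMat_isHermitian S).eq]
  have h2 := Matrix.IsUnit.posDef_star_right_conjugate_iff hS.isUnit
    (x := (1 : ℝ) • 1 + t • toMat (congruence (toMat S)⁻¹ X))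
  rwa [h] at h2

/-- Stationarity of the entropy maximizer: in a direction `X` of the affine span of the
spectrahedron the derivative `tr (P⁻¹ X)` of `log det` vanishes. It is written as the sum of the
eigenvalues of `S⁻¹ X S⁻¹`, where `S` is the square root of `P`. -/
theorem trace_eq_zero_of_isEntropyMaximizer {A : Fin m → Sym N} {b : Fin m → ℝ} {P S : Sym N}
    (hP : IsEntropyMaximizer A b P) (hS : (toMat S).PosDef)
    (hSP : toMat S * toMat S = toMat P) {X : Sym N} (hX : X ∈ LinearMap.ker (opA A)) :
    ∑ j, eig (congruence (toMat S)⁻¹ X) j = 0 := by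
  set l := eig (congruence (toMat S)⁻¹ X) with hl
  have hd : HasDerivAt (fun t : ℝ => ∑ j, Real.log (1 + t * l j)) (∑ j, l j) 0 := by
    refine HasDerivAt.fun_sum fun j _ => ?_
    have h1 : HasDerivAt (fun t : ℝ => 1 + t * l j) (l j) 0 := by
      simpa using ((hasDerivAt_id (0 : ℝ)).mul_const (l j)).const_add 1
    simpa using h1.log (by simp)
  refine IsLocalMax.hasDerivAt_eq_zero ?_ hd
  have hev : ∀ᶠ t : ℝ in nhds 0, ∀ j, 0 < 1 + t * l j := by
    rw [Filter.eventually_all]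
    intro j
    have : Continuous fun t : ℝ => 1 + t * l j := by fun_prop
    exact (isOpen_lt continuous_const this).mem_nhds (by simp)
  filter_upwards [hev] with t ht
  have hpd := (posDef_add_smul_iff hS hSP X t).mpr ht
  have hmem : P + t • X ∈ spectrahedron A b :=
    (mem_spectrahedron_iff hP.1 _).mpr ⟨hpd.posSemidef, Submodule.smul_mem _ _ hX⟩
  have hle := (entropy_le_entropy_iff hpd hP.2.1).mp (hP.2.2 _ hmem hpd)
  rw [det_add_smul hS hSP] at hle
  have hprod : ∏ j, (1 + t * l j) ≤ 1 := by
    have := hP.2.1.det_pos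
    by_contra! hlt
    nlinarith
  rw [← Real.log_prod (fun j _ => (ht j).ne')]
  simpa using Real.log_nonpos (Finset.prod_nonneg fun j _ => (ht j).le) hprod

theorem isEntropyMaximizer_unique {A : Fin m → Sym N} {b : Fin m → ℝ} {P Q : Sym N}
    (hP : IsEntropyMaximizer A b P) (hQ : IsEntropyMaximizer A b Q) : Q = P := by
  obtain ⟨S, hS, hSP, -⟩ := exists_sqrt hP.2.1
  set Z := congruence (toMat S)⁻¹ (Q - P) with hZ
  have hQP : P + (1 : ℝ) • (Q - P) = Q := by rw [one_smul, add_sub_cancel]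
  have hsum := trace_eq_zero_of_isEntropyMaximizer hP hS hSP (sub_mem_ker hP.1 hQ.1)
  have hpos := (posDef_add_smul_iff hS hSP (Q - P) 1).mp (by rw [hQP]; exact hQ.2.1)
  have hdet := det_add_smul hS hSP (Q - P) 1
  simp only [hQP, one_mul, ← hZ] at hpos hdet hsum
  have heq : (toMat Q).det = (toMat P).det :=
    le_antisymm ((entropy_le_entropy_iff hQ.2.1 hP.2.1).mp (hP.2.2 Q hQ.1 hQ.2.1))
      ((entropy_le_entropy_iff hP.2.1 hQ.2.1).mp (hQ.2.2 P hP.1 hP.2.1))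
  have hprod : ∏ j, (1 + eig Z j) = 1 := by
    have := hP.2.1.det_pos
    rw [heq] at hdet
    exact (mul_eq_left₀ this.ne').mp hdet.symm
  have hlog : ∑ j, Real.log (1 + eig Z j) = 0 := by
    rw [← Real.log_prod (fun j _ => (hpos j).ne'), hprod, Real.log_one]
  -- `log (1 + x) ≤ x`, with equality only at `x = 0`
  have hzero : ∀ j, eig Z j = 0 := by
    have hle : ∀ j ∈ Finset.univ, 0 ≤ eig Z j - Real.log (1 + eig Z j) := fun j _ => by
      have := Real.log_le_sub_one_of_pos (hpos j)
      linarith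
    have h0 : ∑ j, (eig Z j - Real.log (1 + eig Z j)) = 0 := by
      rw [Finset.sum_sub_distrib, hsum, hlog, sub_zero]
    intro j
    have h1 := (Finset.sum_eq_zero_iff_of_nonneg hle).mp h0 j (Finset.mem_univ j)
    by_contra hne
    have := Real.log_lt_sub_one_of_pos (hpos j) (by simpa using hne)
    linarith
  have hZ0 : Z = 0 := by
    rw [← norm_eq_zero, ← sq_eq_zero_iff, ← sum_eig_sq]
    simp [hzero]
  have := congruence_inv_cancel (isUnit_det_of_posDef hS) (Q - P)
  rw [← hZ, hZ0, map_zero] at this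
  exact (sub_eq_zero.mp this.symm)

/-! ### The exponential distribution on the slice -/

/-- An injective linear map has the same norms as an endomorphism of its domain, whose determinant
is then the volume factor of the map. -/
theorem exists_endomorphism_norm_eq {E F : Type*} [NormedAddCommGroup E] [InnerProductSpace ℝ E]
    [FiniteDimensional ℝ E] [NormedAddCommGroup F] [InnerProductSpace ℝ F]
    [FiniteDimensional ℝ F] (M : E →ₗ[ℝ] F) (hM : Function.Injective M) :
    ∃ L : E →ₗ[ℝ] E, (∀ x, ‖L x‖ = ‖M x‖) ∧ |LinearMap.det L| = M.normDet := by
  have hrank : Module.finrank ℝ M.range = Module.finrank ℝ E := LinearMap.finrank_range_of_inj hM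
  set e : M.range ≃ₗᵢ[ℝ] E :=
    (stdOrthonormalBasis ℝ M.range).equiv (stdOrthonormalBasis ℝ E) (finCongr hrank) with he
  refine ⟨e.toLinearEquiv.toLinearMap ∘ₗ M.rangeRestrict, fun x => ?_, ?_⟩
  · exact e.norm_map _
  · rw [← LinearMap.normDet_eq_abs_det, LinearMap.normDet_comp_of_finrank_eq _ _ hrank.symm]
    have h1 : e.toLinearEquiv.toLinearMap.normDet = 1 := e.toLinearIsometry.normDet_eq_one
    have h2 : M.rangeRestrict.normDet = M.normDet := LinearMap.normDet_codRestrict _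
    rw [h1, h2, one_mul]

theorem integrable_comp_linearMap {E F : Type*} [NormedAddCommGroup E] [NormedSpace ℝ E]
    [FiniteDimensional ℝ E] [MeasurableSpace E] [BorelSpace E] [NormedAddCommGroup F]
    [NormedSpace ℝ F] (μ : Measure E) [μ.IsAddHaarMeasure] {L : E →ₗ[ℝ] E}
    (hL : LinearMap.det L ≠ 0) {f : E → F} (hf : Integrable f μ) :
    Integrable (fun x => f (L x)) μ := by
  have he := Measure.map_linearMap_addHaar_eq_smul_addHaar μ hL
  refine Integrable.comp_measurable (g := f) ?_
    L.continuous_of_finiteDimensional.measurable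
  rw [he]
  exact hf.smul_measure ENNReal.ofReal_ne_top

theorem gramDet_eq_normDet_sq (T : Sym N →ₗ[ℝ] EuclideanSpace ℝ (Fin m)) :
    gramDet T = (LinearMap.adjoint T).normDet ^ 2 := by
  have := (LinearMap.adjoint T).normDet_sq
  rw [LinearMap.adjoint_adjoint] at this
  exact this.symm

theorem opB_eq {A : Fin m → Sym N} {P S : Sym N} (hS : toMat S = CFC.sqrt (toMat P)) :
    opB A P = opA A ∘ₗ congruence (toMat S) := by
  ext X k
  change (CFC.sqrt (toMat P) * toMat (A k) * CFC.sqrt (toMat P) * toMat X).trace =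
    (toMat (A k) * toMat (congruence (toMat S) X)).trace
  rw [toMat_congruence, toMat_transpose, ← hS, Matrix.mul_assoc, Matrix.mul_assoc,
    Matrix.trace_mul_comm]
  simp only [Matrix.mul_assoc]

theorem adjoint_congruence (S : Sym N) :
    LinearMap.adjoint (congruence (toMat S)) = congruence (toMat S) := by
  symm
  rw [LinearMap.eq_adjoint_iff]
  intro X Y
  rw [inner_eq_trace, inner_eq_trace, toMat_congruence, toMat_congruence, toMat_transpose,
    Matrix.mul_assoc, Matrix.mul_assoc, Matrix.trace_mul_comm]
  simp only [Matrix.mul_assoc]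

theorem gramDet_opA_pos {A : Fin m → Sym N} (hA : LinearIndependent ℝ A) : 0 < gramDet (opA A) := by
  have h : (LinearMap.adjoint (opA A)).normDet ≠ 0 := by
    rw [Ne, LinearMap.normDet_eq_zero_iff_rank_range_ne, not_not, ← LinearMap.orthogonal_ker,
      finrank_orthogonal_ker_opA hA, finrank_euclideanSpace_fin]
  rw [gramDet_eq_normDet_sq]
  positivity

section
variable {E : Type*} [NormedAddCommGroup E] [InnerProductSpace ℝ E]

/-- The kernel of `opA A`, in a model `E` of the Euclidean space `Sym N`. Working in an arbitrary
model keeps the iterated subspaces of `Sym N` out of the measure theory. -/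
noncomputable def modelKer (j : E ≃ₗᵢ[ℝ] Sym N) (A : Fin m → Sym N) : Submodule ℝ E :=
  LinearMap.ker (opA A ∘ₗ j.toLinearEquiv.toLinearMap)

theorem mem_modelKer (j : E ≃ₗᵢ[ℝ] Sym N) (A : Fin m → Sym N) (x : E) :
    x ∈ modelKer j A ↔ j x ∈ LinearMap.ker (opA A) := Iff.rfl

/-- The map `ξ ↦ √P ξ √P` on the orthogonal complement of the kernel of `opA A`. -/
noncomputable def modelCongruence (j : E ≃ₗᵢ[ℝ] Sym N) (A : Fin m → Sym N) (S : Sym N) :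
    (modelKer j A)ᗮ →ₗ[ℝ] Sym N :=
  congruence (toMat S) ∘ₗ j.toLinearEquiv.toLinearMap ∘ₗ (modelKer j A)ᗮ.subtype

theorem modelCongruence_apply (j : E ≃ₗᵢ[ℝ] Sym N) (A : Fin m → Sym N) (S : Sym N)
    (ξ : (modelKer j A)ᗮ) : modelCongruence j A S ξ = congruence (toMat S) (j ξ) := rfl

theorem modelCongruence_injective (j : E ≃ₗᵢ[ℝ] Sym N) (A : Fin m → Sym N) {S : Sym N}
    (hS : (toMat S).PosDef) : Function.Injective (modelCongruence j A S) := by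
  refine Function.Injective.comp (g := congruence (toMat S)) ?_
    (j.injective.comp Subtype.val_injective)
  refine Function.LeftInverse.injective (g := congruence (toMat S)⁻¹) fun X => ?_
  rw [← LinearMap.comp_apply, ← congruence_mul,
      Matrix.nonsing_inv_mul _ (isUnit_det_of_posDef hS), congruence_one, LinearMap.id_apply]

theorem finrank_modelKer (j : E ≃ₗᵢ[ℝ] Sym N) {A : Fin m → Sym N} (hA : LinearIndependent ℝ A) :
    Module.finrank ℝ (modelKer j A) = (N + 1).choose 2 - m := by
  have h : modelKer j A = (LinearMap.ker (opA A)).map j.symm.toLinearEquiv.toLinearMap := by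
    ext x
    constructor
    · intro hx
      exact ⟨j x, hx, j.symm_apply_apply x⟩
    · rintro ⟨y, hy, rfl⟩
      rw [mem_modelKer]
      change j (j.symm y) ∈ _
      rwa [j.apply_symm_apply]
  rw [h, ← finrank_ker_opA hA]
  exact LinearEquiv.finrank_map_eq j.symm.toLinearEquiv _

variable [FiniteDimensional ℝ E]

theorem finrank_orthogonal_modelKer (j : E ≃ₗᵢ[ℝ] Sym N) {A : Fin m → Sym N}
    (hA : LinearIndependent ℝ A) (hm : m ≤ (N + 1).choose 2) :
    Module.finrank ℝ (modelKer j A)ᗮ = m := by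
  have h1 := (modelKer j A).finrank_add_finrank_orthogonal
  rw [finrank_modelKer j hA, j.toLinearEquiv.finrank_eq, finrank_sym] at h1
  omega

/-- The ratio of the Gram determinants is the volume factor of `ξ ↦ √P ξ √P` on the orthogonal
complement of the kernel: the adjoint of `opB A P` is this map after the adjoint of `opA A`, and
volume factors multiply. -/
theorem sqrt_gramDet_div (j : E ≃ₗᵢ[ℝ] Sym N) {A : Fin m → Sym N} {P S : Sym N}
    (hA : LinearIndependent ℝ A) (hm : m ≤ (N + 1).choose 2) (hS : toMat S = CFC.sqrt (toMat P)) :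
    √(gramDet (opA A) / gramDet (opB A P)) = (modelCongruence j A S).normDet⁻¹ := by
  set T := LinearMap.adjoint (opA A) with hT
  set T' : EuclideanSpace ℝ (Fin m) →ₗ[ℝ] E := j.symm.toLinearEquiv.toLinearMap ∘ₗ T with hT'
  have hmem : ∀ y, T' y ∈ (modelKer j A)ᗮ := fun y => by
    rw [Submodule.mem_orthogonal]
    intro x hx
    have h1 : inner ℝ x (T' y) = inner ℝ (j x) (T y) := by
      rw [← j.inner_map_map]
      congr 1
      exact j.apply_symm_apply _
    rw [h1, hT, LinearMap.adjoint_inner_right, (mem_modelKer j A x).mp hx, inner_zero_left]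
  have hB : LinearMap.adjoint (opB A P) =
      modelCongruence j A S ∘ₗ T'.codRestrict _ hmem := by
    rw [opB_eq hS, LinearMap.adjoint_comp, adjoint_congruence]
    ext1 y
    change congruence (toMat S) (T y) = congruence (toMat S) (j (j.symm (T y)))
    rw [j.apply_symm_apply]
  have hTT' : T'.normDet = T.normDet := by
    rw [← sq_eq_sq₀ (LinearMap.normDet_nonneg _) (LinearMap.normDet_nonneg _)]
    have h1 := T'.normDet_sq_eq_det_gram (EuclideanSpace.basisFun (Fin m) ℝ)
    have h2 := T.normDet_sq_eq_det_gram (EuclideanSpace.basisFun (Fin m) ℝ)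
    have h3 : Matrix.gram ℝ (fun i => T' (EuclideanSpace.basisFun (Fin m) ℝ i)) =
        Matrix.gram ℝ (fun i => T (EuclideanSpace.basisFun (Fin m) ℝ i)) := by
      ext i k
      exact j.symm.inner_map_map _ _
    rw [h3] at h1
    exact h1.trans h2.symm
  have hnB : (LinearMap.adjoint (opB A P)).normDet =
      (modelCongruence j A S).normDet * T.normDet := by
    rw [hB, LinearMap.normDet_comp_of_finrank_eq, LinearMap.normDet_codRestrict, hTT']
    rw [finrank_orthogonal_modelKer j hA hm, finrank_euclideanSpace_fin]
  have hpos := gramDet_opA_pos hA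
  have hTpos : T.normDet ≠ 0 := by
    intro h
    rw [gramDet_eq_normDet_sq, ← hT, h] at hpos
    simp at hpos
  rw [gramDet_eq_normDet_sq, gramDet_eq_normDet_sq, hnB, ← hT, mul_pow]
  have h2 : T.normDet ^ 2 / ((modelCongruence j A S).normDet ^ 2 * T.normDet ^ 2) =
      ((modelCongruence j A S).normDet⁻¹) ^ 2 := by
    rw [mul_comm, ← div_div, div_self (pow_ne_zero 2 hTpos), inv_pow, one_div]
  rw [h2, Real.sqrt_sq (inv_nonneg.mpr (LinearMap.normDet_nonneg _))]

end

/-- The density of the exponential distribution on the semidefinite cone, unnormalized. -/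
noncomputable def coneWeight (n : ℝ) (P : Sym N) : Sym N → ℂ :=
  (psdCone N).indicator fun Q => (Real.exp (-(n * ((toMat P)⁻¹ * toMat Q).trace)) : ℂ)

theorem integrable_coneWeight {n : ℝ} (hn : 0 < n) {P : Sym N} (hP : (toMat P).PosDef) :
    Integrable (coneWeight n P) := by
  rw [coneWeight, integrable_indicator_iff measurableSet_psdCone]
  have := integrableOn_exp_neg_trace (hP.inv.smul hn)
  simp only [Matrix.smul_mul, Matrix.trace_smul, smul_eq_mul] at this
  exact Integrable.ofReal this

theorem norm_coneWeight_le {n : ℝ} (hn : 0 < n) {P : Sym N} (hP : (toMat P).PosDef) :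
    ∃ c > 0, ∀ Q, ‖coneWeight n P Q‖ ≤ Real.exp (-(c * ‖Q‖)) := by
  obtain ⟨c, hc, h⟩ := exists_norm_le_trace_mul hP.inv
  refine ⟨n * c, by positivity, fun Q => ?_⟩
  by_cases hQ : Q ∈ psdCone N
  · rw [coneWeight, Set.indicator_of_mem hQ, Complex.norm_real,
      Real.norm_of_nonneg (Real.exp_pos _).le, mul_assoc]
    exact Real.exp_le_exp.mpr (neg_le_neg (mul_le_mul_of_nonneg_left (h Q hQ) hn.le))
  · rw [coneWeight, Set.indicator_of_notMem hQ, norm_zero]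
    positivity

/-- The weight jumps only at the singular points of the cone. -/
theorem continuousAt_coneWeight (n : ℝ) (P : Sym N) {Q : Sym N}
    (h : (toMat Q).PosSemidef → (toMat Q).PosDef) : ContinuousAt (coneWeight n P) Q := by
  by_cases hQ : (toMat Q).PosSemidef
  · have hcont : Continuous fun Q : Sym N =>
        (Real.exp (-(n * ((toMat P)⁻¹ * toMat Q).trace)) : ℂ) :=
      Complex.continuous_ofReal.comp (Real.continuous_exp.comp
        (continuous_const.mul (continuous_trace_mul _)).neg)
    refine hcont.continuousAt.congr ?_
    filter_upwards [isOpen_posDef.mem_nhds (h hQ)] with R hR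
    have : R ∈ psdCone N := Matrix.PosDef.posSemidef hR
    rw [coneWeight, Set.indicator_of_mem this]
  · refine (continuousAt_const (y := (0 : ℂ))).congr ?_
    filter_upwards [isClosed_psdCone.isOpen_compl.mem_nhds hQ] with R hR
    rw [coneWeight, Set.indicator_of_notMem hR]

theorem measurable_coneWeight (n : ℝ) (P : Sym N) : Measurable (coneWeight n P) :=
  (Complex.continuous_ofReal.comp (Real.continuous_exp.comp
    (continuous_const.mul (continuous_trace_mul _)).neg)).measurable.indicator
      measurableSet_psdCone

/-- Continuity of the slice integrals at the slice through `P`, as Fourier inversion at a point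
requires. The weight itself is discontinuous, but only on a null subset of the slice, so dominated
convergence applies. -/
theorem continuousAt_slice_coneWeight {E : Type*} [NormedAddCommGroup E] [InnerProductSpace ℝ E]
    [FiniteDimensional ℝ E] [MeasurableSpace E] [BorelSpace E] (j : E ≃ₗᵢ[ℝ] Sym N) {n : ℝ}
    (hn : 0 < n) {P : Sym N} (hP : (toMat P).PosDef) (K : Submodule ℝ E) :
    ContinuousAt (fun w : Kᗮ => ∫ x : K, coneWeight n P (P + j (x + w))) 0 := by
  obtain ⟨c, hc, hbound⟩ := norm_coneWeight_le hn hP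
  refine continuousAt_of_dominated
    (bound := fun x : K => Real.exp (c * (‖P‖ + 1)) * Real.exp (-(c * ‖x‖))) ?_ ?_ ?_ ?_
  · refine Filter.Eventually.of_forall fun w => ?_
    have hcont : Continuous fun x : K => P + j (x + w) :=
      continuous_const.add (j.continuous.comp (by fun_prop))
    exact ((measurable_coneWeight n P).comp hcont.measurable).aestronglyMeasurable
  · filter_upwards [Metric.ball_mem_nhds (0 : Kᗮ) one_pos] with w hw
    refine Filter.Eventually.of_forall fun x => (hbound _).trans ?_
    rw [← Real.exp_add]
    refine Real.exp_le_exp.mpr ?_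
    have hw1 : ‖j (w : E)‖ < 1 := by
      rw [j.norm_map]
      rw [Metric.mem_ball, dist_zero_right] at hw
      exact hw
    have h1 : ‖j (x : E)‖ ≤ ‖P + j (x + w)‖ + ‖P‖ + ‖j (w : E)‖ := by
      have : j (x : E) = (P + j (x + w)) - P - j w := by rw [map_add]; abel
      calc ‖j (x : E)‖ = ‖(P + j (x + w)) - P - j w‖ := by rw [← this]
        _ ≤ ‖(P + j (x + w)) - P‖ + ‖j (w : E)‖ := norm_sub_le _ _
        _ ≤ _ := by gcongr; exact norm_sub_le _ _
    have h2 : ‖x‖ = ‖j (x : E)‖ := (j.norm_map _).symm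
    rw [h2]
    nlinarith
  · exact (integrable_exp_neg_mul_norm volume hc).const_mul _
  · filter_upwards [ae_slice_posSemidef_imp_posDef (volume : Measure K)
      (j.toLinearEquiv.toLinearMap ∘ₗ K.subtype) hP] with x hx
    have h1 : ContinuousAt (coneWeight n P) (P + j (x + (0 : Kᗮ))) := by
      refine continuousAt_coneWeight n P ?_
      rw [Submodule.coe_zero, add_zero]
      exact hx
    have hcont : Continuous fun w : Kᗮ => P + j (x + w) :=
      continuous_const.add (j.continuous.comp (by fun_prop))
    exact ContinuousAt.comp (f := fun w : Kᗮ => P + j (x + w)) h1 hcont.continuousAt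

/-- The constant `Γ_N det (n P⁻¹) ^ (-n)`, the total mass of the exponential distribution. -/
noncomputable def coneMass (n : ℝ) (P : Sym N) : ℝ :=
  multivariateGamma N n * ((n • (toMat P)⁻¹).det) ^ (-n)

/-- The characteristic function of the centered exponential distribution on the cone. -/
theorem integral_coneWeight_mul_cexp {n : ℝ} (hn : n = ((N : ℝ) + 1) / 2) {S P : Sym N}
    (hS : (toMat S).PosDef) (hSP : toMat S * toMat S = toMat P) (ξ : Sym N) :
    ∫ y, coneWeight n P (P + y) *
        Complex.exp ((-2 * Real.pi * Complex.I) * (inner ℝ ξ y : ℝ)) =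
      coneMass n P * (charFactor n (congruence (toMat S) ξ) (-2 * Real.pi * Complex.I) *
        Complex.exp (2 * Real.pi * Complex.I * ((toMat (congruence (toMat S) ξ)).trace : ℝ))) := by
  have hn0 : 0 < n := by rw [hn]; positivity
  have htr : (toMat (congruence (toMat S) ξ)).trace = inner ℝ ξ P := by
    rw [← trace_mul_eq_trace_congruence, hSP, ← inner_eq_trace, real_inner_comm]
  obtain ⟨z, hz⟩ : ∃ z : ℂ, z = -2 * Real.pi * Complex.I := ⟨_, rfl⟩
  rw [← hz]
  have h1 := integral_add_left_eq_self (μ := (volume : Measure (Sym N)))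
    (fun Q => coneWeight n P Q * Complex.exp (z * (inner ℝ ξ (Q - P) : ℝ))) P
  simp only [add_sub_cancel_left] at h1
  rw [h1]
  have h2 : ∀ Q, coneWeight n P Q * Complex.exp (z * (inner ℝ ξ (Q - P) : ℝ)) =
      (psdCone N).indicator (fun Q => Real.exp (-(n * ((toMat P)⁻¹ * toMat Q).trace)) •
        Complex.exp (z * (inner ℝ ξ Q : ℝ))) Q *
      Complex.exp (2 * Real.pi * Complex.I * (inner ℝ ξ P : ℝ)) := by
    intro Q
    by_cases hQ : Q ∈ psdCone N
    · rw [coneWeight, Set.indicator_of_mem hQ, Set.indicator_of_mem hQ, Complex.real_smul,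
        mul_assoc, ← Complex.exp_add, inner_sub_right, hz]
      congr 2
      push_cast
      ring
    · rw [coneWeight, Set.indicator_of_notMem hQ, Set.indicator_of_notMem hQ]
      simp
  simp_rw [h2]
  rw [integral_mul_const, integral_indicator measurableSet_psdCone, ← hSP,
    integral_cexp_strip hS ξ hn (by rw [hz]; simp; positivity), coneMass, ← hSP, htr, mul_assoc]

/-- The entropy at `P` is the logarithm of `e ^ (n N)` times the mass of the exponential
distribution with mean `P`. -/
theorem exp_entropy {n : ℝ} (hn : n = ((N : ℝ) + 1) / 2) {P : Sym N} (hP : (toMat P).PosDef) :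
    Real.exp (entropy P) = Real.exp (n * N) * coneMass n P := by
  have hn0 : 0 < n := by rw [hn]; positivity
  have hd := hP.det_pos
  have hΓ := multivariateGamma_pos (N := N)
  rw [entropy, coneMass, ← hn]
  rw [← hn] at hΓ
  have hdet : (n • (toMat P)⁻¹).det = n ^ N / (toMat P).det := by
    rw [Matrix.det_smul, Fintype.card_fin, Matrix.det_nonsing_inv, Ring.inverse_eq_inv',
      div_eq_mul_inv]
  rw [hdet, Real.rpow_def_of_pos (by positivity), Real.log_div (by positivity) hd.ne',
    Real.log_pow]
  nth_rewrite 2 [← Real.exp_log hΓ]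
  rw [← Real.exp_add, ← Real.exp_add]
  congr 1
  have h1 : Real.log (((N : ℝ) + 1) / (2 * Real.exp 1)) = Real.log n - 1 := by
    have : ((N : ℝ) + 1) / (2 * Real.exp 1) = n / Real.exp 1 := by rw [hn]; field_simp
    rw [this, Real.log_div hn0.ne' (Real.exp_pos _).ne', Real.log_exp]
  rw [h1]
  have h2 : (N : ℝ) * (N + 1) / 2 = n * N := by rw [hn]; ring
  rw [h2]
  ring

/-- The density is constant on the affine span of the spectrahedron, so that its integral over the
slice is a multiple of the volume. -/
theorem integral_slice_coneWeight {E : Type*} [NormedAddCommGroup E] [InnerProductSpace ℝ E]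
    [FiniteDimensional ℝ E] [MeasurableSpace E] [BorelSpace E] (j : E ≃ₗᵢ[ℝ] Sym N) (n : ℝ)
    {A : Fin m → Sym N} {b : Fin m → ℝ} {P : Sym N}
    (hA : LinearIndependent ℝ A) (hP : IsEntropyMaximizer A b P) :
    ∫ x : modelKer j A, coneWeight n P (P + j x) =
      (Real.exp (-(n * N)) * spectrahedronVolume A b : ℝ) := by
  obtain ⟨S, hS, hSP, -⟩ := exists_sqrt hP.2.1
  set K := modelKer j A with hK
  set s : Set K := {x | (toMat (P + j (x : E))).PosSemidef} with hs
  have hiso : Isometry fun x : K => P + j (x : E) :=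
    (isometry_add_left P).comp (j.isometry.comp isometry_subtype_coe)
  have himage : (fun x : K => P + j (x : E)) '' s = spectrahedron A b := by
    ext Q
    constructor
    · rintro ⟨x, hx, rfl⟩
      exact (mem_spectrahedron_iff hP.1 _).mpr ⟨hx, x.2⟩
    · intro hQ
      have h1 : P + j (j.symm (Q - P)) = Q := by rw [j.apply_symm_apply, add_sub_cancel]
      refine ⟨⟨j.symm (Q - P), ?_⟩, ?_, h1⟩
      · rw [hK, mem_modelKer, j.apply_symm_apply]
        exact sub_mem_ker hP.1 hQ
      · change (toMat (P + j (j.symm (Q - P)))).PosSemidef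
        rw [h1]
        exact hQ.1
  have hvol : spectrahedronVolume A b = (volume s).toReal := by
    rw [spectrahedronVolume, ← himage, hiso.euclideanHausdorffMeasure_image,
      ← finrank_modelKer j hA, InnerProductSpace.euclideanHausdorffMeasure_eq_volume]
  have hsm : MeasurableSet s := by
    have : Continuous fun x : K => P + j (x : E) :=
      continuous_const.add (j.continuous.comp continuous_subtype_val)
    exact measurableSet_psdCone.preimage this.measurable
  have htr : ∀ x : K, ((toMat P)⁻¹ * toMat (P + j (x : E))).trace = (N : ℝ) := by
    intro x
    have h1 := trace_eq_zero_of_isEntropyMaximizer hP hS hSP ((mem_modelKer j A x).mp x.2)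
    rw [← trace_eq_sum_eig, toMat_congruence, Matrix.transpose_nonsing_inv, toMat_transpose,
      Matrix.mul_assoc, Matrix.trace_mul_comm, Matrix.mul_assoc, ← Matrix.mul_inv_rev, hSP,
      Matrix.trace_mul_comm] at h1
    rw [toMat_add, Matrix.mul_add, Matrix.trace_add, h1,
      Matrix.nonsing_inv_mul _ (isUnit_det_of_posDef hP.2.1), Matrix.trace_one, Fintype.card_fin,
      add_zero]
  have hfun : (fun x : K => coneWeight n P (P + j (x : E))) =
      s.indicator fun _ => (Real.exp (-(n * N)) : ℂ) := by
    ext x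
    by_cases hx : x ∈ s
    · have : P + j (x : E) ∈ psdCone N := hx
      rw [coneWeight, Set.indicator_of_mem this, Set.indicator_of_mem hx, htr]
    · have : P + j (x : E) ∉ psdCone N := hx
      rw [coneWeight, Set.indicator_of_notMem this, Set.indicator_of_notMem hx]
  rw [hfun, integral_indicator hsm, setIntegral_const, hvol, Complex.real_smul, mul_comm]
  push_cast
  rfl

/-! ### The volume estimate -/

section
variable {V : Type*} [NormedAddCommGroup V] [InnerProductSpace ℝ V] [FiniteDimensional ℝ V]
  [MeasurableSpace V] [BorelSpace V]

theorem integrable_gaussian_add_error {n : ℝ} (hn : (Module.finrank ℝ V : ℝ) + 3 < n) :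
    Integrable fun v : V => Real.exp (-(n / 2) * ‖v‖ ^ 2) +
      n / 3 * (‖v‖ ^ 3 * (1 + ‖v‖ ^ 2) ^ (-n / 2)) := by
  have hn0 : 0 < n := lt_trans (by positivity) hn
  refine (integrable_exp_neg_mul_sq_norm (by positivity)).add (Integrable.const_mul ?_ _)
  exact integrable_norm_pow_mul_rpow (k := 3) (by exact_mod_cast hn)

/-- A function that is close to a Gaussian has nearly the integral of the Gaussian. The change of
variables `L` is only applied to the two radial functions. -/
theorem norm_integral_sub_gaussian_le [Nontrivial V] {n : ℝ}
    (hn : 1000 * (Module.finrank ℝ V : ℝ) ^ 2 ≤ n) {L : V →ₗ[ℝ] V} (hL : LinearMap.det L ≠ 0)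
    {c : ℝ} (hc : 0 ≤ c) {Φ : V → ℂ} (hΦ : AEStronglyMeasurable Φ)
    (h : ∀ v, ‖Φ v - (c * Real.exp (-(n / 2) * ‖L v‖ ^ 2) : ℝ)‖ ≤
      c * (n / 3 * (‖L v‖ ^ 3 * (1 + ‖L v‖ ^ 2) ^ (-n / 2)))) :
    ‖(∫ v, Φ v) - (c * (|LinearMap.det L|⁻¹ *
        (2 * Real.pi / n) ^ ((Module.finrank ℝ V : ℝ) / 2)) : ℝ)‖ ≤
      c * (|LinearMap.det L|⁻¹ * (2 * Real.pi / n) ^ ((Module.finrank ℝ V : ℝ) / 2)) *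
        ((Module.finrank ℝ V : ℝ) * √((Module.finrank ℝ V : ℝ) / n)) := by
  have hm1 : (1 : ℝ) ≤ Module.finrank ℝ V := by exact_mod_cast Module.finrank_pos (R := ℝ) (M := V)
  have hn0 : 0 < n := by nlinarith
  have hG : Integrable fun v : V => c * Real.exp (-(n / 2) * ‖L v‖ ^ 2) :=
    (integrable_comp_linearMap volume hL
      (integrable_exp_neg_mul_sq_norm (V := V) (c := n / 2) (by positivity))).const_mul c
  have hGc : Integrable fun v : V => ((c * Real.exp (-(n / 2) * ‖L v‖ ^ 2) : ℝ) : ℂ) := hG.ofReal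
  have hH : Integrable fun v : V => c * (n / 3 * (‖L v‖ ^ 3 * (1 + ‖L v‖ ^ 2) ^ (-n / 2))) :=
    (integrable_comp_linearMap volume hL ((integrable_norm_pow_mul_rpow (V := V) (n := n) (k := 3)
      (by push_cast; nlinarith)).const_mul (n / 3))).const_mul c
  have hD : Integrable fun v => Φ v - (c * Real.exp (-(n / 2) * ‖L v‖ ^ 2) : ℝ) :=
    hH.mono' (hΦ.sub hGc.aestronglyMeasurable) (Filter.Eventually.of_forall h)
  have hΦi : Integrable Φ := by
    refine (hD.add hGc).congr (Filter.Eventually.of_forall fun v => ?_)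
    exact sub_add_cancel _ _
  have hGval : ∫ v : V, c * Real.exp (-(n / 2) * ‖L v‖ ^ 2) = c * (|LinearMap.det L|⁻¹ *
      (2 * Real.pi / n) ^ ((Module.finrank ℝ V : ℝ) / 2)) := by
    rw [integral_const_mul, integral_comp_linearMap volume hL
      (fun v : V => Real.exp (-(n / 2) * ‖v‖ ^ 2)), integral_exp_neg_half_mul_sq_norm hn0,
      smul_eq_mul]
  have hHval : ∫ v : V, c * (n / 3 * (‖L v‖ ^ 3 * (1 + ‖L v‖ ^ 2) ^ (-n / 2))) ≤
      c * (|LinearMap.det L|⁻¹ * ((Module.finrank ℝ V : ℝ) * √((Module.finrank ℝ V : ℝ) / n) *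
        (2 * Real.pi / n) ^ ((Module.finrank ℝ V : ℝ) / 2))) := by
    rw [integral_const_mul, integral_comp_linearMap volume hL
      (fun v : V => n / 3 * (‖v‖ ^ 3 * (1 + ‖v‖ ^ 2) ^ (-n / 2))), smul_eq_mul]
    gcongr
    exact integral_error_le hn
  rw [← hGval, ← integral_complex_ofReal, ← integral_sub hΦi hGc]
  calc _ ≤ _ := norm_integral_le_of_norm_le hH (Filter.Eventually.of_forall h)
    _ ≤ _ := hHval
    _ = _ := by rw [hGval]; ring

end

theorem coneMass_pos {n : ℝ} (hn : n = ((N : ℝ) + 1) / 2) {P : Sym N} (hP : (toMat P).PosDef) :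
    0 < coneMass n P := by
  have h := exp_entropy hn hP
  exact (pos_iff_pos_of_mul_pos (h ▸ Real.exp_pos (entropy P))).mp (Real.exp_pos _)

theorem normDet_modelCongruence_pos {E : Type*} [NormedAddCommGroup E] [InnerProductSpace ℝ E]
    [FiniteDimensional ℝ E] (j : E ≃ₗᵢ[ℝ] Sym N) (A : Fin m → Sym N) {S : Sym N}
    (hS : (toMat S).PosDef) : 0 < (modelCongruence j A S).normDet := by
  refine lt_of_le_of_ne (LinearMap.normDet_nonneg _) (Ne.symm ?_)
  rw [Ne, LinearMap.normDet_eq_zero_iff_ker_ne_bot, not_not, LinearMap.ker_eq_bot]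
  exact modelCongruence_injective j A hS

/-- The approximation formula is `e ^ (n N)` times the integral of the Gaussian that replaces the
characteristic function, after the substitution `ξ ↦ (2 π / n) √P ξ √P`. -/
theorem volumeFormula_eq {E : Type*} [NormedAddCommGroup E] [InnerProductSpace ℝ E]
    [FiniteDimensional ℝ E] (j : E ≃ₗᵢ[ℝ] Sym N) {n : ℝ} (hn : n = ((N : ℝ) + 1) / 2)
    {A : Fin m → Sym N} {P S : Sym N} (hA : LinearIndependent ℝ A) (hm : m ≤ (N + 1).choose 2)
    (hP : (toMat P).PosDef) (hS : toMat S = CFC.sqrt (toMat P)) :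
    volumeFormula A P = Real.exp (n * N) * (coneMass n P *
      (((2 * Real.pi / n) ^ m * (modelCongruence j A S).normDet)⁻¹ *
        (2 * Real.pi / n) ^ ((m : ℝ) / 2))) := by
  have hn0 : 0 < n := by rw [hn]; positivity
  have h1 : ((N : ℝ) + 1) / (4 * Real.pi) = (2 * Real.pi / n)⁻¹ := by rw [hn]; field_simp; ring
  have h2 : ((2 * Real.pi / n)⁻¹) ^ ((m : ℝ) / 2) =
      ((2 * Real.pi / n) ^ m)⁻¹ * (2 * Real.pi / n) ^ ((m : ℝ) / 2) := by
    have ht : 0 < 2 * Real.pi / n := by positivity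
    rw [Real.inv_rpow ht.le, ← Real.rpow_natCast, ← Real.rpow_neg ht.le, ← Real.rpow_neg ht.le,
      ← Real.rpow_add ht]
    congr 1
    ring
  rw [volumeFormula, h1, h2, sqrt_gramDet_div j hA hm hS, exp_entropy hn hP, mul_inv]
  ring

/-- The volume estimate, in terms of `m` and `n = (N + 1) / 2` alone. Fourier inversion on the
slice through `P` turns the volume into the integral of the
characteristic function, which is then replaced by the Gaussian. -/
theorem abs_volume_sub_le {E : Type*} [NormedAddCommGroup E] [InnerProductSpace ℝ E]
    [FiniteDimensional ℝ E] [MeasurableSpace E] [BorelSpace E] (j : E ≃ₗᵢ[ℝ] Sym N) {n : ℝ}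
    (hn : n = ((N : ℝ) + 1) / 2) {A : Fin m → Sym N} {b : Fin m → ℝ} {P : Sym N}
    (hA : LinearIndependent ℝ A) (hm : m ≤ (N + 1).choose 2) (hm0 : 0 < m)
    (hmn : 1000 * (m : ℝ) ^ 2 ≤ n) (hP : IsEntropyMaximizer A b P) :
    |spectrahedronVolume A b - volumeFormula A P| ≤ volumeFormula A P * (m * √(m / n)) := by
  have hn0 : 0 < n := by rw [hn]; positivity
  obtain ⟨S, hS, hSP, hsqrt⟩ := exists_sqrt hP.2.1
  set V := (modelKer j A)ᗮ with hV
  have hrank : Module.finrank ℝ V = m := finrank_orthogonal_modelKer j hA hm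
  have : Nontrivial V := Module.nontrivial_of_finrank_pos (R := ℝ) (hrank ▸ hm0)
  set M := modelCongruence j A S with hM
  obtain ⟨L, hLnorm, hLdet⟩ := exists_endomorphism_norm_eq M (modelCongruence_injective j A hS)
  set L' : V →ₗ[ℝ] V := (2 * Real.pi / n) • L with hL'
  have ht : 0 < 2 * Real.pi / n := by positivity
  have hL'det : |LinearMap.det L'| = (2 * Real.pi / n) ^ m * M.normDet := by
    rw [hL', LinearMap.det_smul, abs_mul, hLdet, hrank, abs_of_pos (pow_pos ht m)]
  have hMpos : M.normDet ≠ 0 := (normDet_modelCongruence_pos j A hS).ne'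
  have hdet0 : LinearMap.det L' ≠ 0 := by
    rw [← abs_ne_zero, hL'det]
    exact mul_ne_zero (pow_pos ht m).ne' hMpos
  have hmn' : 1000 * (Module.finrank ℝ V : ℝ) ^ 2 ≤ n := by rw [hrank]; exact hmn
  have hc := coneMass_pos hn hP.2.1
  set c := coneMass n P with hcdef
  set h : E → ℂ := fun y => coneWeight n P (P + j y) with hh
  have hint : Integrable h :=
    (j.measurePreserving.integrable_comp_emb j.toHomeomorph.measurableEmbedding).mpr
      ((integrable_coneWeight hn0 hP.2.1).comp_add_left P)
  have hfourier : ∀ ξ : V, ∫ y, h y * Complex.exp ((-2 * Real.pi * Complex.I) *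
      (inner ℝ (ξ : E) y : ℝ)) = c * (charFactor n (M ξ) (-2 * Real.pi * Complex.I) *
        Complex.exp (2 * Real.pi * Complex.I * ((toMat (M ξ)).trace : ℝ))) := by
    intro ξ
    rw [hM, modelCongruence_apply, ← integral_coneWeight_mul_cexp hn hS hSP,
      ← j.measurePreserving.integral_comp j.toHomeomorph.measurableEmbedding]
    simp only [j.inner_map_map, hh]
  have herr : ∀ ξ : V, ‖(∫ y, h y * Complex.exp ((-2 * Real.pi * Complex.I) *
      (inner ℝ (ξ : E) y : ℝ))) - (c * Real.exp (-(n / 2) * ‖L' ξ‖ ^ 2) : ℝ)‖ ≤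
      c * (n / 3 * (‖L' ξ‖ ^ 3 * (1 + ‖L' ξ‖ ^ 2) ^ (-n / 2))) := by
    intro ξ
    have hρ : ‖L' ξ‖ = 2 * Real.pi / n * ‖M ξ‖ := by
      rw [hL', LinearMap.smul_apply, norm_smul, hLnorm, Real.norm_of_nonneg ht.le]
    rw [hfourier, Complex.ofReal_mul, ← mul_sub, norm_mul, Complex.norm_real,
      Real.norm_of_nonneg hc.le]
    exact mul_le_mul_of_nonneg_left (norm_charFactor_sub_le hn0 (M ξ) hρ) hc.le
  have hm1 : (1 : ℝ) ≤ m := by exact_mod_cast hm0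
  have hbi := (integrable_comp_linearMap volume hdet0 (integrable_gaussian_add_error (V := V)
    (n := n) (by rw [hrank]; nlinarith))).const_mul c
  obtain ⟨heq, hmeas⟩ := integral_slice_eq (modelKer j A) hint
    (continuousAt_slice_coneWeight j hn0 hP.2.1 _) hbi fun ξ => by
      have h1 := norm_le_norm_add_norm_sub' (∫ y, h y * Complex.exp ((-2 * Real.pi * Complex.I) *
        (inner ℝ (ξ : E) y : ℝ))) (c * Real.exp (-(n / 2) * ‖L' ξ‖ ^ 2) : ℝ)
      rw [Complex.norm_real, Real.norm_of_nonneg (by positivity)] at h1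
      rw [mul_add]
      exact h1.trans (add_le_add_right (herr ξ) _)
  have hmain := norm_integral_sub_gaussian_le hmn' hdet0 hc.le hmeas herr
  rw [← heq, hh, integral_slice_coneWeight j n hA hP, hrank, hL'det, ← Complex.ofReal_sub,
    Complex.norm_real, Real.norm_eq_abs] at hmain
  rw [volumeFormula_eq j hn hA hm hP.2.1 hsqrt]
  set W := c * (((2 * Real.pi / n) ^ m * M.normDet)⁻¹ * (2 * Real.pi / n) ^ ((m : ℝ) / 2)) with hW
  have hexp : Real.exp (n * N) * Real.exp (-(n * N)) = 1 := by rw [← Real.exp_add]; simp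
  have hsplit : spectrahedronVolume A b - Real.exp (n * N) * W =
      Real.exp (n * N) * (Real.exp (-(n * N)) * spectrahedronVolume A b - W) := by
    linear_combination (-spectrahedronVolume A b) * hexp
  rw [hsplit, abs_mul, abs_of_pos (Real.exp_pos _), mul_assoc]
  exact mul_le_mul_of_nonneg_left hmain (Real.exp_pos _).le

theorem volumeFormula_pos {E : Type*} [NormedAddCommGroup E] [InnerProductSpace ℝ E]
    [FiniteDimensional ℝ E] (j : E ≃ₗᵢ[ℝ] Sym N) {A : Fin m → Sym N} {P : Sym N}
    (hA : LinearIndependent ℝ A) (hm : m ≤ (N + 1).choose 2) (hP : (toMat P).PosDef) :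
    0 < volumeFormula A P := by
  obtain ⟨S, hS, -, hsqrt⟩ := exists_sqrt hP
  have h1 := normDet_modelCongruence_pos j A hS
  rw [volumeFormula, sqrt_gramDet_div j hA hm hsqrt]
  positivity

/-- Without equations the spectrahedron is the whole cone, which is unbounded. -/
theorem pos_of_isCompact_spectrahedron {A : Fin m → Sym N} {b : Fin m → ℝ} (hN : 0 < N)
    (hc : IsCompact (spectrahedron A b)) : 0 < m := by
  rw [Nat.pos_iff_ne_zero]
  rintro rfl
  obtain ⟨R, hR⟩ := hc.isBounded.exists_norm_le
  set I : Sym N := ofMat 1 (by simp) with hI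
  have hmem : ∀ t : ℝ, 0 ≤ t → t • I ∈ spectrahedron A b := fun t ht => by
    refine ⟨?_, fun k => k.elim0⟩
    rw [toMat_smul, hI, toMat_ofMat]
    exact Matrix.PosSemidef.one.smul ht
  have hI0 : 0 < ‖I‖ := by
    rw [norm_pos_iff]
    intro h
    have := congrArg (fun X => toMat X ⟨0, hN⟩ ⟨0, hN⟩) h
    simp [hI, toMat_ofMat, toMat_zero] at this
  have h1 := hR _ (hmem ((|R| + 1) / ‖I‖) (by positivity))
  rw [norm_smul, Real.norm_of_nonneg (by positivity), div_mul_cancel₀ _ hI0.ne'] at h1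
  linarith [le_abs_self R]

/-- The consequences of the assumption on `ε` that the proof uses. -/
theorem size_bounds (hN : 2 ≤ N) (hm : 0 < m) {ε : ℝ} (hε_pos : 0 < ε)
    (hε_le : ε ≤ Real.exp (-1))
    (hε : (32 * 10 ^ 5 : ℝ) * (m : ℝ) ^ 3 * Real.log (N : ℝ) / (N : ℝ) ≤
      ε ^ 2 / Real.log ε⁻¹ ^ 3) :
    m < N ∧ 1000 * (m : ℝ) ^ 2 ≤ ((N : ℝ) + 1) / 2 ∧
      m * √(m / (((N : ℝ) + 1) / 2)) ≤ ε := by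
  have hN2 : (2 : ℝ) ≤ N := by exact_mod_cast hN
  have hm1 : (1 : ℝ) ≤ m := by exact_mod_cast hm
  have hlogε : 1 ≤ Real.log ε⁻¹ := by
    rw [Real.log_inv]
    have := Real.log_le_log hε_pos hε_le
    rw [Real.log_exp] at this
    linarith
  have hε1 : ε ≤ 1 := hε_le.trans (Real.exp_le_one_iff.mpr (by norm_num))
  have hlogN : 1 / 2 ≤ Real.log N := by
    have h1 := Real.log_le_log (by norm_num) hN2
    linarith [Real.log_two_gt_d9]
  have h1 : ε ^ 2 / Real.log ε⁻¹ ^ 3 ≤ ε ^ 2 :=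
    div_le_self (by positivity) (one_le_pow₀ hlogε)
  have h2 := hε.trans h1
  rw [div_le_iff₀ (by positivity)] at h2
  have h3 : 1600000 * (m : ℝ) ^ 3 ≤ ε ^ 2 * N := by
    refine le_trans ?_ h2
    have : 0 < (m : ℝ) ^ 3 := by positivity
    nlinarith
  have h4 : 1600000 * (m : ℝ) ^ 3 ≤ N :=
    h3.trans (mul_le_of_le_one_left (by positivity) (pow_le_one₀ hε_pos.le hε1))
  have hm2 : (m : ℝ) ^ 2 ≤ (m : ℝ) ^ 3 := pow_le_pow_right₀ hm1 (by norm_num)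
  have hm3 : (m : ℝ) ≤ (m : ℝ) ^ 3 := le_self_pow₀ hm1 (by norm_num)
  refine ⟨?_, by linarith, ?_⟩
  · have : (m : ℝ) < N := by linarith
    exact_mod_cast this
  · refine abs_le_of_sq_le_sq' ?_ hε_pos.le |>.2
    rw [mul_pow, Real.sq_sqrt (by positivity), ← mul_div_assoc, div_le_iff₀ (by positivity)]
    nlinarith [sq_nonneg ε]

end SpectraVol

theorem theorem2p1 (N m : ℕ) (A : Fin m → SpectraVol.Sym N) (b : Fin m → ℝ)
    (hcompact : IsCompact (SpectraVol.spectrahedron A b))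
    (hindep : LinearIndependent ℝ A)
    (hm : m < (N + 1).choose 2)
    (hdim : Module.finrank ℝ (vectorSpan ℝ (SpectraVol.spectrahedron A b)) =
      (N + 1).choose 2 - m)
    (ε : ℝ) (hε_pos : 0 < ε) (hε_le : ε ≤ Real.exp (-1))
    (hε : (32 * 10 ^ 5 : ℝ) * (m : ℝ) ^ 3 * Real.log (N : ℝ) / (N : ℝ) ≤
      ε ^ 2 / Real.log ε⁻¹ ^ 3) :
    ∃ P : SpectraVol.Sym N, SpectraVol.IsEntropyMaximizer A b P ∧
      (∀ Q : SpectraVol.Sym N, SpectraVol.IsEntropyMaximizer A b Q → Q = P) ∧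
      |SpectraVol.spectrahedronVolume A b / SpectraVol.volumeFormula A P - 1| ≤ ε := by
  have hN : 0 < N := by
    rcases Nat.eq_zero_or_pos N with rfl | h
    · simp at hm
    · exact h
  have hm0 := SpectraVol.pos_of_isCompact_spectrahedron hN hcompact
  have hN2 : 2 ≤ N := by
    by_contra h
    obtain rfl : N = 1 := by omega
    simp at hm
    omega
  obtain ⟨hmN, hmn, hle⟩ := SpectraVol.size_bounds hN2 hm0 hε_pos hε_le hε
  have hne : (SpectraVol.spectrahedron A b).Nonempty := by
    rw [Set.nonempty_iff_ne_empty]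
    intro h
    rw [h, vectorSpan_empty, finrank_bot] at hdim
    omega
  obtain ⟨P, hP⟩ := SpectraVol.exists_isEntropyMaximizer hcompact
    (SpectraVol.exists_posDef_mem_spectrahedron hindep hne hmN hdim)
  refine ⟨P, hP, fun Q hQ => SpectraVol.isEntropyMaximizer_unique hP hQ, ?_⟩
  -- Any Euclidean model of `Sym N` will do.
  have j := (stdOrthonormalBasis ℝ (SpectraVol.Sym N)).repr.symm
  have hF := SpectraVol.volumeFormula_pos j hindep hm.le hP.2.1
  have h := SpectraVol.abs_volume_sub_le j rfl hindep hm.le hm0 hmn hP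
  rw [div_sub_one hF.ne', abs_div, abs_of_pos hF, div_le_iff₀ hF, mul_comm ε]
  exact h.trans (mul_le_mul_of_nonneg_left hle hF.le)
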